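/- **Theorem 4.1.** Let $g>0$, $B>0$ and $A,\gamma,Q,p_0\in\mathbb R$. Let $\eta:\mathbb R\to(0,\infty)$ be a $2\pi$-periodic $C^1$ function, let $\Omega=\{(x,y):0<y<\eta(x)\}$, and let $\psi\in C^2(\overline\Omega)$ be $2\pi$-periodic in $x$. Suppose that $\psi$ and $\eta$ solve the steady stratified water wave problem without surface tension, with density $\rho(-\psi)=A\psi+B$ and constant Bernoulli function $-\beta(\psi)=\gamma$, that is, $$ \begin{cases} \Delta\psi+Agy=\gamma & \text{in } 0<y<\eta(x),\\ |\nabla\psi|^2+2gBy=Q & \text{on } y=\eta(x),\\ \psi=0 & \text{on } y=\eta(x),\\ \psi=-p_0 & \text{on } y=0. \end{cases} $$ Suppose that the wave profile is monotone between crest and trough, with the troughs at $x=\pm\pi$: there is $c\in(-\pi,\pi)$ such that $\eta$ is non-decreasing on $[-\pi,c]$ and non-increasing on $[c,\pi]$. Internal stagnation points are allowed, but all points of $\overline\Omega$ with $\psi_y=0$ lie strictly below the trough level $y=\eta(\pi)$ (in particular $\psi_y\neq0$ on the free surface). Then $\psi$ is symmetric about $x=0$: for every $(x,y)\in\overline\Omega$,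 also $(-x,y)\in\overline\Omega$ and $\psi(-x,y)=\psi(x,y)$. Consequently $\eta$ is even, $\eta(-x)=\eta(x)$ for all $x$, and $x=0$ is a crest line, that is, $\eta$ attains its maximum at $x=0$. -/

import Mathlib

open Set

/-- The open fluid region `0 < y < η x` below the graph of `η` and above the flat bed `y = 0`. -/
def fluid (η : ℝ → ℝ) : Set (ℝ × ℝ) := {p | 0 < p.2 ∧ p.2 < η p.1}

/-- The fluid region together with the bed and the free surface. -/
def closedFluid (η : ℝ → ℝ) : Set (ℝ × ℝ) := {p | 0 ≤ p.2 ∧ p.2 ≤ η p.1}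

/-- `∂f/∂x` relative to the set `s`. It is the usual partial derivative at interior points of `s`,
and the derivative up to the boundary at boundary points. -/
noncomputable def partialX (s : Set (ℝ × ℝ)) (f : ℝ × ℝ → ℝ) (p : ℝ × ℝ) : ℝ :=
  fderivWithin ℝ f s p (1, 0)

/-- `∂f/∂y` relative to the set `s`. -/
noncomputable def partialY (s : Set (ℝ × ℝ)) (f : ℝ × ℝ → ℝ) (p : ℝ × ℝ) : ℝ :=
  fderivWithin ℝ f s p (0, 1)

/-- The regularity and periodicity of a wave of period `2π`: a positive `C¹` profile `η`, and a
stream function `ψ` which is `C²` up to the boundary of the fluid. The values of `ψ` outside the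
closed fluid region play no role. -/
structure IsPeriodicFlow (η : ℝ → ℝ) (ψ : ℝ × ℝ → ℝ) : Prop where
  profile_contDiff : ContDiff ℝ 1 η
  profile_periodic : ∀ x, η (x + 2 * Real.pi) = η x
  profile_pos : ∀ x, 0 < η x
  contDiffOn : ContDiffOn ℝ 2 ψ (closedFluid η)
  periodic : ∀ x y, (x, y) ∈ closedFluid η → ψ (x + 2 * Real.pi, y) = ψ (x, y)

/-- The free boundary problem for the (relative pseudo-)stream function without surface tension, with
density `ρ(-ψ) = A ψ + B` and constant Bernoulli function `-β(ψ) = γ`: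
`Δψ + A g y = γ` in the fluid, `|∇ψ|² + 2 g B y = Q` and `ψ = 0` on the free surface, and
`ψ = -p₀` on the bed. -/
structure SolvesStratifiedSystem (g A B γ Q p₀ : ℝ) (η : ℝ → ℝ) (ψ : ℝ × ℝ → ℝ) : Prop where
  field : ∀ x y, (x, y) ∈ fluid η →
    partialX (closedFluid η) (partialX (closedFluid η) ψ) (x, y)
      + partialY (closedFluid η) (partialY (closedFluid η) ψ) (x, y) + A * g * y = γ
  bernoulli : ∀ x,
    partialX (closedFluid η) ψ (x, η x) ^ 2 + partialY (closedFluid η) ψ (x, η x) ^ 2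
      + 2 * g * B * η x = Q
  surface : ∀ x, ψ (x, η x) = 0
  bed : ∀ x, ψ (x, 0) = -p₀

/-- The profile is monotone between crest and trough: the troughs are at `x = ±π`, and there is a
crest somewhere between them, with `η` non-decreasing from the left trough up to the crest and
non-increasing from the crest down to the right trough. The position of the crest is not
prescribed. -/
def MonotoneCrestTrough (η : ℝ → ℝ) : Prop :=
  ∃ c ∈ Ioo (-Real.pi) Real.pi,
    MonotoneOn η (Icc (-Real.pi) c) ∧ AntitoneOn η (Icc c Real.pi)

/-- All points of the closed fluid region with `ψ_y = 0` (that is, with horizontal velocity equal to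
the wave speed) lie strictly below the height `η π` of the trough. When the trough is the lowest
point of the profile this includes `ψ_y ≠ 0` on the free surface. -/
def StagnationBelowTrough (η : ℝ → ℝ) (ψ : ℝ × ℝ → ℝ) : Prop :=
  ∀ x y, (x, y) ∈ closedFluid η → partialY (closedFluid η) ψ (x, y) = 0 → y < η Real.pi

open Filter Topology

/-! The wave is compared with its mirror image, as in the method of moving planes. Because `γ - A g
y` depends on height alone, the difference between `ψ` and its reflection in a vertical axis is
harmonic, on the half period where the reflected profile lies above the original one. The difference
vanishes on the axis, on the bed and, by periodicity, on the line half a period away. From trough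
level upwards `ψ_y` has a constant sign `σ`, so `σ ψ < 0` strictly below the surface there; hence
`σ` times the difference is nonnegative on the top. By the minimum principles it is either
identically zero or positive inside.

Moving the axis as far right as the ordering permits forces an interior contact of the two profiles,
or a horizontal tangent on the axis or half a period from it (`exists_touching_axis`). Positivity
fails in each case. At a contact point the slopes match after reflection and Bernoulli's law equates
the values of `ψ_y`, so the vertical derivative of the difference vanishes, against Hopf's linear
growth (`exists_hopf_lower_bound`). At a horizontal tangent on the axis, differentiating Bernoulli's
law along the surface kills `ψ_xy`, so the difference is `o(t²)` on the diagonal, against Serrin's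
quadratic growth (`exists_corner_lower_bound`). The flow is therefore symmetric about some axis `l`.

This does not yet give `l = 0`, since the trough could be flat. But symmetry about `l`, combined
with monotonicity, orders the profile against its reflection in `x = π`, where the slope vanishes
because of the trough. The corner argument there gives symmetry about `π`, hence about `0` by
periodicity. -/

/-! ### Minimum principles for harmonic functions in the plane. -/

theorem InnerProductSpace.HarmonicAt.eventually_eq_of_isLocalMin {u : ℂ → ℝ} {c : ℂ}
    (hu : InnerProductSpace.HarmonicAt u c) (hc : IsLocalMin u c) : ∀ᶠ z in 𝓝 c, u z = u c := by
  obtain ⟨r, hr, hball⟩ := Metric.eventually_nhds_iff_ball.1 hu.eventually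
  obtain ⟨F, hF, hre⟩ :=
    InnerProductSpace.HarmonicOnNhd.exists_analyticOnNhd_ball_re_eq (z := c) (R := r) (f := u) hball
  have hmem : ∀ᶠ z in 𝓝 c, z ∈ Metric.ball c r := Metric.ball_mem_nhds c hr
  -- With `u = Re F`, the modulus of `exp (-F)` is largest where `u` is least, so the maximum
  -- modulus principle applies.
  have hnorm : ∀ z ∈ Metric.ball c r, ‖Complex.exp (-F z)‖ = Real.exp (-u z) := by
    intro z hz
    rw [Complex.norm_exp, Complex.neg_re, ← hre hz]
  have hd : ∀ᶠ z in 𝓝 c, DifferentiableAt ℂ (fun z => Complex.exp (-F z)) z := by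
    filter_upwards [hmem] with z hz
    exact (hF z hz).differentiableAt.neg.cexp
  have hcc := mem_of_mem_nhds hmem
  have hmax : IsLocalMax (norm ∘ fun z => Complex.exp (-F z)) c := by
    filter_upwards [hmem, hc] with z hz hle
    simp only [Function.comp_apply]
    rw [hnorm z hz, hnorm c hcc]
    exact Real.exp_le_exp.2 (neg_le_neg hle)
  filter_upwards [hmem, Complex.eventually_eq_of_isLocalMax_norm hd hmax] with z hz h
  have := congrArg norm h
  rw [hnorm z hz, hnorm c hcc] at this
  exact neg_injective (Real.exp_injective this)

/-- Weak minimum principle on an open subset `D` of a compact set `K`. -/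
theorem InnerProductSpace.HarmonicOnNhd.nonneg_of_nonneg_diff {u : ℂ → ℝ} {D K : Set ℂ}
    (hu : InnerProductSpace.HarmonicOnNhd u D) (hD : IsOpen D) (hK : IsCompact K) (hDK : D ⊆ K)
    (hcont : ContinuousOn u K) (hb : ∀ z ∈ K, z ∉ D → 0 ≤ u z) : ∀ z ∈ K, 0 ≤ u z := by
  by_contra! h
  obtain ⟨z₀, hz₀, hneg⟩ := h
  obtain ⟨q, hq, hmin⟩ := hK.exists_isMinOn ⟨z₀, hz₀⟩ hcont
  have hqneg : u q < 0 := (hmin hz₀).trans_lt hneg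
  set E : Set ℂ := K ∩ u ⁻¹' {u q} with hE
  have hED : ∀ z ∈ E, z ∈ D := by
    intro z hz
    by_contra hzD
    have := hb z hz.1 hzD
    have h2 : u z = u q := hz.2
    linarith
  have hclosed : IsClosed E := hcont.preimage_isClosed_of_isClosed hK.isClosed isClosed_singleton
  have hopen : IsOpen E := by
    rw [isOpen_iff_mem_nhds]
    intro z hz
    have hzD := hED z hz
    have huz : u z = u q := hz.2
    have hloc : IsLocalMin u z := by
      filter_upwards [hD.mem_nhds hzD] with y hy
      rw [huz]
      exact hmin (hDK hy)
    filter_upwards [hD.mem_nhds hzD, (hu z hzD).eventually_eq_of_isLocalMin hloc] with y hy hyz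
    exact ⟨hDK hy, hyz.trans huz⟩
  -- The minimum set is clopen in the whole plane, nonempty, and contained in a compact set, which
  -- is impossible.
  rcases isClopen_iff.1 ⟨hclosed, hopen⟩ with h | h
  · exact (h ▸ (⟨hq, rfl⟩ : q ∈ E) : q ∈ (∅ : Set ℂ))
  · exact noncompact_univ ℂ (h ▸ hK.of_isClosed_subset hclosed inter_subset_left)

/-- Strong minimum principle. -/
theorem InnerProductSpace.HarmonicOnNhd.eqOn_zero_of_nonneg {u : ℂ → ℝ} {D : Set ℂ}
    (hu : InnerProductSpace.HarmonicOnNhd u D) (hD : IsOpen D) (hDc : IsPreconnected D)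
    (hpos : ∀ z ∈ D, 0 ≤ u z) {q : ℂ} (hq : q ∈ D) (huq : u q = 0) : ∀ z ∈ D, u z = 0 := by
  by_contra! h
  obtain ⟨z₁, hz₁, hne⟩ := h
  have h1 : IsOpen (D ∩ u ⁻¹' {0}) := by
    rw [isOpen_iff_mem_nhds]
    rintro z ⟨hz, huz⟩
    have huz : u z = 0 := huz
    have hloc : IsLocalMin u z := by
      filter_upwards [hD.mem_nhds hz] with y hy
      rw [huz]
      exact hpos y hy
    filter_upwards [hD.mem_nhds hz, (hu z hz).eventually_eq_of_isLocalMin hloc] with y hy hyz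
    exact ⟨hy, hyz.trans huz⟩
  have h2 : IsOpen (D ∩ u ⁻¹' {0}ᶜ) := hu.continuousOn.isOpen_inter_preimage hD isOpen_compl_singleton
  obtain ⟨z, hz, hz1, hz2⟩ := hDc _ _ h1 h2
    (fun z hz => (em (u z = 0)).imp (fun h => ⟨hz, h⟩) (fun h => ⟨hz, h⟩))
    ⟨q, hq, hq, huq⟩ ⟨z₁, hz₁, hz₁, hne⟩
  exact hz2.2 hz1.2

/-! ### Boundary point and corner barriers. -/

/-- Hopf's boundary point estimate in a region bounded by a conic through `p` with inner normal
`conj n`, by comparison with the harmonic function `Re (ζ + k ζ ^ 2)`, `ζ = n (z - p)`. -/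
theorem exists_hopf_lower_bound {u : ℂ → ℝ} {p n : ℂ} (hn : n ≠ 0) {k τ : ℝ} (hk : 0 < k)
    (hτ : 0 < τ)
    (hcont : ContinuousOn u {z | 0 ≤ (n * (z - p)).re ∧ (n * (z - p)).re ≤ τ ∧
      k * (n * (z - p)).im ^ 2 ≤ (n * (z - p)).re + k * (n * (z - p)).re ^ 2})
    (hu : InnerProductSpace.HarmonicOnNhd u {z | 0 < (n * (z - p)).re ∧ (n * (z - p)).re < τ ∧
      k * (n * (z - p)).im ^ 2 < (n * (z - p)).re + k * (n * (z - p)).re ^ 2})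
    (hnonneg : ∀ z, 0 ≤ (n * (z - p)).re → (n * (z - p)).re ≤ τ →
      k * (n * (z - p)).im ^ 2 ≤ (n * (z - p)).re + k * (n * (z - p)).re ^ 2 → 0 ≤ u z)
    (hpos : ∀ z, (n * (z - p)).re = τ →
      k * (n * (z - p)).im ^ 2 ≤ (n * (z - p)).re + k * (n * (z - p)).re ^ 2 → 0 < u z) :
    ∃ ε > 0, ∀ z, 0 ≤ (n * (z - p)).re → (n * (z - p)).re ≤ τ →
      k * (n * (z - p)).im ^ 2 ≤ (n * (z - p)).re + k * (n * (z - p)).re ^ 2 →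
      ε * ((n * (z - p)).re + k * (n * (z - p)).re ^ 2 - k * (n * (z - p)).im ^ 2) ≤ u z := by
  set G : Set ℂ := {z | 0 < (n * (z - p)).re ∧ (n * (z - p)).re < τ ∧
      k * (n * (z - p)).im ^ 2 < (n * (z - p)).re + k * (n * (z - p)).re ^ 2} with hG
  set C : Set ℂ := {z | 0 ≤ (n * (z - p)).re ∧ (n * (z - p)).re ≤ τ ∧
      k * (n * (z - p)).im ^ 2 ≤ (n * (z - p)).re + k * (n * (z - p)).re ^ 2} with hC
  have hGo : IsOpen G := by
    refine IsOpen.and ?_ (IsOpen.and ?_ ?_) <;> apply isOpen_lt <;> fun_prop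
  have hCc : IsClosed C := by
    refine IsClosed.and ?_ (IsClosed.and ?_ ?_) <;> apply isClosed_le <;> fun_prop
  have hCK : IsCompact C := by
    set R : ℝ := τ + (τ + k * τ ^ 2 + k) / k with hR
    refine (isCompact_closedBall p (R / ‖n‖)).of_isClosed_subset hCc ?_
    intro z hz
    obtain ⟨h1, h2, h3⟩ := hz
    rw [mem_closedBall_iff_norm, le_div_iff₀ (norm_pos_iff.2 hn), mul_comm, ← norm_mul]
    refine (Complex.norm_le_abs_re_add_abs_im _).trans ?_
    set ℓ := (n * (z - p)).re
    set m := (n * (z - p)).im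
    rw [abs_of_nonneg h1]
    refine add_le_add h2 ?_
    rw [le_div_iff₀ hk]
    have h4 : |m| ≤ m ^ 2 + 1 := by nlinarith [sq_abs m, sq_nonneg (|m| - 1), abs_nonneg m]
    have h5 : ℓ ^ 2 ≤ τ ^ 2 := by gcongr
    nlinarith
  have hGC : G ⊆ C := fun z hz => ⟨hz.1.le, hz.2.1.le, hz.2.2.le⟩
  obtain ⟨c, hc, hcu⟩ : ∃ c > 0, ∀ z ∈ C, (n * (z - p)).re = τ → c ≤ u z := by
    have hK : IsCompact (C ∩ {z | (n * (z - p)).re = τ}) :=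
      hCK.inter_right (isClosed_eq (by fun_prop) (by fun_prop))
    rcases (C ∩ {z | (n * (z - p)).re = τ}).eq_empty_or_nonempty with h | h
    · refine ⟨1, one_pos, fun z hz hz' => ?_⟩
      have hmem : z ∈ C ∩ {z | (n * (z - p)).re = τ} := ⟨hz, hz'⟩
      rw [h] at hmem
      exact absurd hmem (notMem_empty z)
    · obtain ⟨q, hq, hmin⟩ := hK.exists_isMinOn h (hcont.mono inter_subset_left)
      exact ⟨u q, hpos q hq.2 hq.1.2.2, fun z hz hz' => hmin ⟨hz, hz'⟩⟩
  -- On the edge `re ζ = τ` the barrier is at most `τ + k τ²` and `u ≥ c`; on the rest of the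
  -- boundary the barrier is at most zero.
  refine ⟨c / (τ + k * τ ^ 2), by positivity, ?_⟩
  set ε := c / (τ + k * τ ^ 2) with hε
  have hεpos : 0 < ε := by positivity
  set b : ℂ → ℝ := fun z => (n * (z - p) + k * (n * (z - p)) ^ 2).re with hb
  have hbz : ∀ z, b z = (n * (z - p)).re + k * (n * (z - p)).re ^ 2 - k * (n * (z - p)).im ^ 2 := by
    intro z
    simp only [hb, sq, Complex.add_re, Complex.re_ofReal_mul]
    rw [Complex.mul_re (n * (z - p)) (n * (z - p))]
    ring
  have hbh : ∀ z, InnerProductSpace.HarmonicAt b z := by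
    intro z
    have : AnalyticAt ℂ (fun z => n * (z - p) + k * (n * (z - p)) ^ 2) z := by fun_prop
    exact this.harmonicAt_re
  have key : ∀ z ∈ C, 0 ≤ (u - ε • b) z := by
    refine InnerProductSpace.HarmonicOnNhd.nonneg_of_nonneg_diff (D := G)
      (hu.sub fun z _ => (hbh z).const_smul) hGo hCK hGC ?_ ?_
    · exact hcont.sub (ContinuousOn.const_smul (fun z _ => (hbh z).1.continuousAt.continuousWithinAt) ε)
    · rintro z ⟨h1, h2, h3⟩ hzG
      simp only [Pi.sub_apply, Pi.smul_apply, smul_eq_mul, hbz]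
      rcases h2.eq_or_lt with h2' | h2'
      · have hcz := hcu z ⟨h1, h2, h3⟩ h2'
        have : ε * (τ + k * τ ^ 2) = c := div_mul_cancel₀ _ (by positivity)
        rw [h2']
        nlinarith [sq_nonneg (n * (z - p)).im, mul_pos hεpos hk]
      · have hu0 := hnonneg z h1 h2 h3
        suffices h : (n * (z - p)).re + k * (n * (z - p)).re ^ 2 ≤ k * (n * (z - p)).im ^ 2 by
          nlinarith
        by_contra! hlt
        rcases h1.eq_or_lt with h0 | h0
        · rw [← h0] at hlt
          nlinarith [mul_nonneg hk.le (sq_nonneg (n * (z - p)).im)]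
        · exact hzG ⟨h0, h2', hlt⟩
  intro z h1 h2 h3
  have := key z ⟨h1, h2, h3⟩
  simp only [Pi.sub_apply, Pi.smul_apply, smul_eq_mul, hbz] at this
  linarith

/-- Serrin's corner estimate at a right-angled corner `i h` with vertical side on the imaginary
axis, by comparison with the harmonic function `s (t + 3 k t ^ 2 - k s ^ 2)`, where `s` is the
distance to the vertical side and `t` is the depth. -/
theorem exists_corner_lower_bound {u : ℂ → ℝ} {h k τ : ℝ} (hk : 0 < k) (hτ : 0 < τ)
    (hcont : ContinuousOn u {z | 0 ≤ z.re ∧ 0 ≤ h - z.im ∧ h - z.im ≤ τ ∧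
      k * z.re ^ 2 ≤ (h - z.im) + 3 * k * (h - z.im) ^ 2})
    (hu : InnerProductSpace.HarmonicOnNhd u {z | 0 < z.re ∧ 0 < h - z.im ∧ h - z.im < τ ∧
      k * z.re ^ 2 < (h - z.im) + 3 * k * (h - z.im) ^ 2})
    (hnonneg : ∀ z : ℂ, 0 ≤ z.re → 0 ≤ h - z.im → h - z.im ≤ τ →
      k * z.re ^ 2 ≤ (h - z.im) + 3 * k * (h - z.im) ^ 2 → 0 ≤ u z)
    {c : ℝ} (hc : 0 < c)
    (hbot : ∀ z : ℂ, 0 ≤ z.re → h - z.im = τ →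
      k * z.re ^ 2 ≤ τ + 3 * k * τ ^ 2 → c * z.re ≤ u z) :
    ∃ ε > 0, ∀ z : ℂ, 0 ≤ z.re → 0 ≤ h - z.im → h - z.im ≤ τ →
      k * z.re ^ 2 ≤ (h - z.im) + 3 * k * (h - z.im) ^ 2 →
      ε * (z.re * ((h - z.im) + 3 * k * (h - z.im) ^ 2 - k * z.re ^ 2)) ≤ u z := by
  set G : Set ℂ := {z | 0 < z.re ∧ 0 < h - z.im ∧ h - z.im < τ ∧
      k * z.re ^ 2 < (h - z.im) + 3 * k * (h - z.im) ^ 2} with hG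
  set C : Set ℂ := {z | 0 ≤ z.re ∧ 0 ≤ h - z.im ∧ h - z.im ≤ τ ∧
      k * z.re ^ 2 ≤ (h - z.im) + 3 * k * (h - z.im) ^ 2} with hC
  have hGo : IsOpen G := by
    refine IsOpen.and ?_ (IsOpen.and ?_ (IsOpen.and ?_ ?_)) <;> apply isOpen_lt <;> fun_prop
  have hCc : IsClosed C := by
    refine IsClosed.and ?_ (IsClosed.and ?_ (IsClosed.and ?_ ?_)) <;> apply isClosed_le <;> fun_prop
  have hCK : IsCompact C := by
    refine (IsCompact.reProdIm (s := Icc 0 ((τ + 3 * k * τ ^ 2 + k) / k)) (t := Icc (h - τ) h)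
      isCompact_Icc isCompact_Icc).of_isClosed_subset hCc ?_
    rintro z ⟨h1, h2, h3, h4⟩
    refine ⟨⟨h1, ?_⟩, ⟨by linarith, by linarith⟩⟩
    rw [le_div_iff₀ hk]
    have h5 : (h - z.im) ^ 2 ≤ τ ^ 2 := by gcongr
    nlinarith [sq_nonneg (z.re - 1), mul_nonneg hk.le (sq_nonneg (z.re - 1))]
  have hGC : G ⊆ C := fun z hz => ⟨hz.1.le, hz.2.1.le, hz.2.2.1.le, hz.2.2.2.le⟩
  -- On the bottom edge the barrier is at most `z.re * (τ + 3 k τ²)`. It vanishes linearly at the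
  -- axis, so a linear lower bound on `u` suffices there.
  refine ⟨c / (τ + 3 * k * τ ^ 2), by positivity, ?_⟩
  set ε := c / (τ + 3 * k * τ ^ 2) with hε
  have hεpos : 0 < ε := by positivity
  set b : ℂ → ℝ := fun z =>
    (Complex.I / 2 * (z - Complex.I * h) ^ 2 - k * (z - Complex.I * h) ^ 3).re with hb
  have hbz : ∀ z, b z = z.re * ((h - z.im) + 3 * k * (h - z.im) ^ 2 - k * z.re ^ 2) := by
    intro z
    have h1 : z - Complex.I * h = ⟨z.re, -(h - z.im)⟩ := by apply Complex.ext <;> simp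
    have h2 : Complex.I / 2 = ⟨0, 1 / 2⟩ := by apply Complex.ext <;> simp
    have h3 : (k : ℂ) = ⟨k, 0⟩ := rfl
    change (Complex.I / 2 * (z - Complex.I * h) ^ 2 - k * (z - Complex.I * h) ^ 3).re = _
    rw [h1, h2, h3]
    simp only [pow_succ, pow_zero, one_mul, Complex.sub_re, Complex.mul_re,
      Complex.mul_im]
    ring
  have hbh : ∀ z, InnerProductSpace.HarmonicAt b z := by
    intro z
    have : AnalyticAt ℂ (fun z => Complex.I / 2 * (z - Complex.I * h) ^ 2
      - k * (z - Complex.I * h) ^ 3) z := by fun_prop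
    exact this.harmonicAt_re
  have key : ∀ z ∈ C, 0 ≤ (u - ε • b) z := by
    refine InnerProductSpace.HarmonicOnNhd.nonneg_of_nonneg_diff (D := G)
      (hu.sub fun z _ => (hbh z).const_smul) hGo hCK hGC ?_ ?_
    · exact hcont.sub (ContinuousOn.const_smul (fun z _ => (hbh z).1.continuousAt.continuousWithinAt) ε)
    · rintro z ⟨h1, h2, h3, h4⟩ hzG
      simp only [Pi.sub_apply, Pi.smul_apply, smul_eq_mul, hbz]
      rcases h3.eq_or_lt with h3' | h3'
      · have hcz := hbot z h1 h3' (h3' ▸ h4)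
        have hce : ε * (τ + 3 * k * τ ^ 2) = c := div_mul_cancel₀ _ (by positivity)
        have hce' : c * z.re = ε * (τ + 3 * k * τ ^ 2) * z.re := by rw [hce]
        have : 0 ≤ ε * z.re * (k * z.re ^ 2) := by positivity
        rw [h3']
        linarith
      · have hu0 := hnonneg z h1 h2 h3 h4
        suffices h : z.re * ((h - z.im) + 3 * k * (h - z.im) ^ 2 - k * z.re ^ 2) ≤ 0 by
          nlinarith
        rcases h1.eq_or_lt with h0 | h0
        · rw [← h0]; simp
        · refine mul_nonpos_of_nonneg_of_nonpos h1 ?_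
          by_contra! hlt
          rcases h2.eq_or_lt with h5 | h5
          · rw [← h5] at hlt
            nlinarith [mul_pos hk (pow_pos h0 2)]
          · exact hzG ⟨h0, h5, h3', by linarith⟩
  intro z h1 h2 h3 h4
  have := key z ⟨h1, h2, h3, h4⟩
  simp only [Pi.sub_apply, Pi.smul_apply, smul_eq_mul, hbz] at this
  linarith

/-! ### Growth of positive harmonic functions at the boundary of a subgraph. -/

/-- The part of the subgraph of `E` between the vertical lines `re z = 0` and `re z = a`. -/
def profileCell (a : ℝ) (E : ℝ → ℝ) : Set ℂ :=
  {z | 0 < z.re ∧ z.re < a ∧ 0 < z.im ∧ z.im < E z.re}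

/-- The part of the closed subgraph of `E` between `re z = 0` and `re z = a`. -/
def closedProfileCell (a : ℝ) (E : ℝ → ℝ) : Set ℂ :=
  {z | 0 ≤ z.re ∧ z.re ≤ a ∧ 0 ≤ z.im ∧ z.im ≤ E z.re}

section ProfileCell

variable {a : ℝ} {E : ℝ → ℝ}

theorem profileCell_subset_closed : profileCell a E ⊆ closedProfileCell a E :=
  fun _ hz => ⟨hz.1.le, hz.2.1.le, hz.2.2.1.le, hz.2.2.2.le⟩

theorem isOpen_profileCell (hE : Continuous E) : IsOpen (profileCell a E) := by
  refine IsOpen.and ?_ (IsOpen.and ?_ (IsOpen.and ?_ ?_)) <;> apply isOpen_lt <;> fun_prop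

theorem profileCell_eq_image (hpos : ∀ s, 0 < E s) :
    profileCell a E = (fun q : ℝ × ℝ => (⟨q.1, q.2 * E q.1⟩ : ℂ)) '' (Ioo 0 a ×ˢ Ioo 0 1) := by
  ext z
  constructor
  · rintro ⟨h1, h2, h3, h4⟩
    refine ⟨(z.re, z.im / E z.re), ⟨⟨h1, h2⟩, div_pos h3 (hpos _), (div_lt_one (hpos _)).2 h4⟩, ?_⟩
    apply Complex.ext
    · rfl
    · exact div_mul_cancel₀ _ (hpos _).ne'
  · rintro ⟨⟨s, t⟩, ⟨⟨h1, h2⟩, h3, h4⟩, rfl⟩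
    exact ⟨h1, h2, mul_pos h3 (hpos _), mul_lt_of_lt_one_left (hpos _) h4⟩

theorem closedProfileCell_eq_image (hpos : ∀ s, 0 < E s) : closedProfileCell a E =
    (fun q : ℝ × ℝ => (⟨q.1, q.2 * E q.1⟩ : ℂ)) '' (Icc 0 a ×ˢ Icc 0 1) := by
  ext z
  constructor
  · rintro ⟨h1, h2, h3, h4⟩
    refine ⟨(z.re, z.im / E z.re),
      ⟨⟨h1, h2⟩, div_nonneg h3 (hpos _).le, (div_le_one (hpos _)).2 h4⟩, ?_⟩
    apply Complex.ext
    · rfl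
    · exact div_mul_cancel₀ _ (hpos _).ne'
  · rintro ⟨⟨s, t⟩, ⟨⟨h1, h2⟩, h3, h4⟩, rfl⟩
    exact ⟨h1, h2, mul_nonneg h3 (hpos _).le, mul_le_of_le_one_left (hpos _).le h4⟩

theorem continuous_profileCell_param (hE : Continuous E) :
    Continuous (fun q : ℝ × ℝ => (⟨q.1, q.2 * E q.1⟩ : ℂ)) :=
  Complex.equivRealProdCLM.symm.continuous.comp
    (continuous_fst.prodMk (continuous_snd.mul (hE.comp continuous_fst)))

theorem isPreconnected_profileCell (hE : Continuous E) (hpos : ∀ s, 0 < E s) :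
    IsPreconnected (profileCell a E) := by
  rw [profileCell_eq_image hpos]
  exact (isPreconnected_Ioo.prod isPreconnected_Ioo).image _
    (continuous_profileCell_param hE).continuousOn

theorem isCompact_closedProfileCell (hE : Continuous E) (hpos : ∀ s, 0 < E s) :
    IsCompact (closedProfileCell a E) := by
  rw [closedProfileCell_eq_image hpos]
  exact (isCompact_Icc.prod isCompact_Icc).image (continuous_profileCell_param hE)

theorem closedProfileCell_subset_closure (ha : 0 < a) (hE : Continuous E) (hpos : ∀ s, 0 < E s) :
    closedProfileCell a E ⊆ closure (profileCell a E) := by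
  rw [closedProfileCell_eq_image hpos, profileCell_eq_image hpos, ← closure_Ioo ha.ne,
    ← closure_Ioo (zero_ne_one (α := ℝ)), ← closure_prod_eq]
  exact image_closure_subset_closure_image (continuous_profileCell_param hE)

variable {u : ℂ → ℝ}

theorem nonneg_and_pos_or_zero_of_boundary_nonneg (ha : 0 < a) (hE : Continuous E)
    (hpos : ∀ s, 0 < E s) (hu : InnerProductSpace.HarmonicOnNhd u (profileCell a E))
    (hcont : ContinuousOn u (closedProfileCell a E))
    (hb : ∀ z ∈ closedProfileCell a E, z ∉ profileCell a E → 0 ≤ u z) :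
    (∀ z ∈ closedProfileCell a E, 0 ≤ u z) ∧
      ((∀ z ∈ profileCell a E, 0 < u z) ∨ ∀ z ∈ closedProfileCell a E, u z = 0) := by
  have h0 := hu.nonneg_of_nonneg_diff (isOpen_profileCell hE)
    (isCompact_closedProfileCell hE hpos) profileCell_subset_closed hcont hb
  refine ⟨h0, ?_⟩
  by_cases h : ∀ z ∈ profileCell a E, 0 < u z
  · exact Or.inl h
  right
  push Not at h
  obtain ⟨q, hq, hle⟩ := h
  have hz := hu.eqOn_zero_of_nonneg (isOpen_profileCell hE) (isPreconnected_profileCell hE hpos)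
    (fun z hz => h0 z (profileCell_subset_closed hz)) hq
    (le_antisymm hle (h0 q (profileCell_subset_closed hq)))
  have : EqOn u (fun _ => 0) (closedProfileCell a E) :=
    EqOn.of_subset_closure (fun z h => hz z h) hcont continuousOn_const profileCell_subset_closed
      (closedProfileCell_subset_closure ha hE hpos)
  exact this

variable (hE : Continuous E) (hpos : ∀ s, 0 < E s)
  (hu : InnerProductSpace.HarmonicOnNhd u (profileCell a E))
  (hcont : ContinuousOn u (closedProfileCell a E))
  (hnonneg : ∀ z ∈ closedProfileCell a E, 0 ≤ u z) (hup : ∀ z ∈ profileCell a E, 0 < u z)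

-- A one-sided quadratic bound on `E` at one point serves as the interior ball condition: a narrow
-- conic region aligned with the normal fits under the graph, and Hopf's barrier in it is comparable
-- to the vertical depth.
include hpos hu hcont hnonneg hup in
theorem exists_linear_lower_bound_below_top {s₀ m K δ : ℝ} (hs₀ : s₀ ∈ Ioo 0 a) (hK : 0 < K)
    (hδ : 0 < δ)
    (hquad : ∀ s, |s - s₀| < δ → E s₀ + m * (s - s₀) - K * (s - s₀) ^ 2 ≤ E s) :
    ∃ ε > 0, ∃ τ > 0, ∀ t ∈ Ioo 0 τ, ε * t ≤ u ⟨s₀, E s₀ - t⟩ := by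
  obtain ⟨δ', hδ', h1, h2, h3, h4⟩ : ∃ d > 0, d ≤ δ ∧ d ≤ s₀ ∧ d ≤ a - s₀ ∧
      d ≤ E s₀ / (2 * (|m| + 1)) := by
    have := hpos s₀
    refine ⟨min (min δ s₀) (min (a - s₀) (E s₀ / (2 * (|m| + 1)))), ?_, ?_, ?_, ?_, ?_⟩
    · have := hs₀.1
      have := sub_pos.2 hs₀.2
      positivity
    · exact (min_le_left _ _).trans (min_le_left _ _)
    · exact (min_le_left _ _).trans (min_le_right _ _)
    · exact (min_le_right _ _).trans (min_le_left _ _)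
    · exact (min_le_right _ _).trans (min_le_right _ _)
  have hmδ : |m| * δ' < E s₀ / 2 := by
    rw [le_div_iff₀ (by positivity)] at h4
    nlinarith
  -- The factor 16 and the bounds on `τ` keep `K (x - s₀)²` at most half of `re ζ`, the vertical
  -- depth below the tangent line.
  set k : ℝ := 16 * K with hk
  have hkpos : 0 < k := by positivity
  obtain ⟨τ, hτ, t1, t2, t3, t4⟩ : ∃ d > 0, d ≤ 1 / k ∧ d ≤ 1 / (8 * K * (m ^ 2 + 1)) ∧
      d ≤ K * δ' ^ 2 ∧ d ≤ E s₀ / 2 := by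
    have := hpos s₀
    refine ⟨min (min (1 / k) (1 / (8 * K * (m ^ 2 + 1)))) (min (K * δ' ^ 2) (E s₀ / 2)),
      by positivity, ?_, ?_, ?_, ?_⟩
    · exact (min_le_left _ _).trans (min_le_left _ _)
    · exact (min_le_left _ _).trans (min_le_right _ _)
    · exact (min_le_right _ _).trans (min_le_left _ _)
    · exact (min_le_right _ _).trans (min_le_right _ _)
  rw [le_div_iff₀ hkpos] at t1
  rw [le_div_iff₀ (by positivity)] at t2
  set n : ℂ := ⟨m, 1⟩ with hn
  set p : ℂ := ⟨s₀, E s₀⟩ with hp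
  have hre : ∀ z : ℂ, (n * (z - p)).re = m * (z.re - s₀) - (z.im - E s₀) := by
    intro z; simp [hn, hp, Complex.mul_re]
  have him : ∀ z : ℂ, (n * (z - p)).im = m * (z.im - E s₀) + (z.re - s₀) := by
    intro z; simp [hn, hp, Complex.mul_im]
  have hgeom : ∀ z : ℂ, 0 ≤ (n * (z - p)).re → (n * (z - p)).re ≤ τ →
      k * (n * (z - p)).im ^ 2 ≤ (n * (z - p)).re + k * (n * (z - p)).re ^ 2 →
      (z.re - s₀) ^ 2 * K ≤ (n * (z - p)).re / 2 := by
    intro z h1 h2 h3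
    have e : (1 + m ^ 2) * (z.re - s₀) = (n * (z - p)).im + m * (n * (z - p)).re := by
      rw [hre, him]; ring
    set ℓ := (n * (z - p)).re
    set q := (n * (z - p)).im
    have e1 : k * ℓ ^ 2 ≤ ℓ := by nlinarith [mul_nonneg hkpos.le h1]
    have e2 : K * q ^ 2 ≤ ℓ / 8 := by rw [hk] at h3 e1; linarith
    have e3 : K * m ^ 2 * ℓ ^ 2 ≤ ℓ / 8 := by
      have : 8 * K * m ^ 2 * ℓ ≤ 1 := by
        have : 8 * K * m ^ 2 * ℓ ≤ 8 * K * m ^ 2 * τ := by gcongr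
        nlinarith
      nlinarith
    have e4 : (z.re - s₀) ^ 2 ≤ ((1 + m ^ 2) * (z.re - s₀)) ^ 2 := by
      rw [mul_pow]
      nlinarith [sq_nonneg (z.re - s₀), sq_nonneg m,
        mul_nonneg (sq_nonneg (z.re - s₀)) (sq_nonneg m)]
    have e5 : ((1 + m ^ 2) * (z.re - s₀)) ^ 2 ≤ 2 * q ^ 2 + 2 * m ^ 2 * ℓ ^ 2 := by
      rw [e]; nlinarith [sq_nonneg (q - m * ℓ)]
    nlinarith
  have hcell : ∀ z : ℂ, 0 < (n * (z - p)).re → (n * (z - p)).re ≤ τ →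
      k * (n * (z - p)).im ^ 2 ≤ (n * (z - p)).re + k * (n * (z - p)).re ^ 2 →
      z ∈ profileCell a E := by
    intro z h1' h2' h3'
    have hq := hgeom z h1'.le h2' h3'
    have hlt : (z.re - s₀) ^ 2 < δ' ^ 2 := by nlinarith
    have habs : |z.re - s₀| < δ' := abs_lt_of_sq_lt_sq hlt hδ'.le
    have hEz := hquad z.re (habs.trans_le h1)
    have hm : |m * (z.re - s₀)| ≤ |m| * δ' := by rw [abs_mul]; gcongr
    have hm' := abs_le.1 hm
    have habs' := abs_lt.1 habs
    rw [hre] at h1' h2' hq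
    exact ⟨by linarith, by linarith, by linarith, by linarith⟩
  have hclosed : ∀ z : ℂ, 0 ≤ (n * (z - p)).re → (n * (z - p)).re ≤ τ →
      k * (n * (z - p)).im ^ 2 ≤ (n * (z - p)).re + k * (n * (z - p)).re ^ 2 →
      z ∈ closedProfileCell a E := by
    intro z h1' h2' h3'
    rcases h1'.eq_or_lt with h0 | h0
    · have hq := hgeom z h1' h2' h3'
      rw [← h0] at hq
      have hx : z.re - s₀ = 0 := by
        by_contra hne
        have := mul_pos (pow_pos (abs_pos.2 hne) 2) hK
        rw [sq_abs] at this
        linarith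
      rw [hre, hx] at h0
      have hx' : z.re = s₀ := by linarith
      refine ⟨by linarith [hs₀.1], by linarith [hs₀.2], ?_, ?_⟩
      · linarith [hpos s₀]
      · rw [hx']; linarith
    · exact profileCell_subset_closed (hcell z h0 h2' h3')
  have hn0 : n ≠ 0 := fun h => by simpa [hn] using congrArg Complex.im h
  obtain ⟨ε, hε, hbound⟩ := exists_hopf_lower_bound (u := u) (p := p) hn0 hkpos hτ
    (hcont.mono fun z hz => hclosed z hz.1 hz.2.1 hz.2.2)
    (hu.mono fun z hz => hcell z hz.1 hz.2.1.le hz.2.2.le)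
    (fun z h1 h2 h3 => hnonneg z (hclosed z h1 h2 h3))
    (fun z h1 h3 => hup z (hcell z (by rw [h1]; exact hτ) h1.le h3))
  refine ⟨ε / 2, by positivity, min τ (1 / (2 * k * (m ^ 2 + 1))), by positivity, ?_⟩
  intro t ht
  have ht1 : t < τ := ht.2.trans_le (min_le_left _ _)
  have ht2 : t < 1 / (2 * k * (m ^ 2 + 1)) := ht.2.trans_le (min_le_right _ _)
  rw [lt_div_iff₀ (by positivity)] at ht2
  have ht0 := ht.1
  have hr : (n * ((⟨s₀, E s₀ - t⟩ : ℂ) - p)).re = t := by rw [hre]; simp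
  have hi : (n * ((⟨s₀, E s₀ - t⟩ : ℂ) - p)).im = -(m * t) := by rw [him]; simp
  have hsmall : k * (m * t) ^ 2 ≤ t / 2 := by nlinarith [mul_pos hkpos ht0, mul_pos ht0 ht0]
  have := hbound ⟨s₀, E s₀ - t⟩ (by rw [hr]; exact ht0.le) (by rw [hr]; exact ht1.le)
    (by rw [hr, hi]; nlinarith [mul_pos hkpos (mul_pos ht0 ht0)])
  rw [hr, hi] at this
  refine le_trans ?_ this
  have h5 : t / 2 ≤ t + k * t ^ 2 - k * (-(m * t)) ^ 2 := by
    nlinarith [mul_pos hkpos (mul_pos ht0 ht0)]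
  calc ε / 2 * t = ε * (t / 2) := by ring
    _ ≤ _ := by gcongr

-- Hopf's estimate on the vertical side, with `n = 1`. It feeds the bottom edge of the corner
-- region.
include hE hu hcont hnonneg hup in
theorem exists_linear_lower_bound_beside_axis (ha : 0 < a) {y₀ : ℝ} (hy₀ : y₀ ∈ Ioo 0 (E 0)) :
    ∃ ε > 0, ∃ δ > 0, ∀ s ∈ Icc 0 δ, ε * s ≤ u ⟨s, y₀⟩ := by
  obtain ⟨r, hr, hra, hry, hrE⟩ : ∃ r > 0, r < a ∧ r < y₀ ∧ ∀ s, |s| ≤ r → y₀ + r < E s := by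
    have h1 : ∀ᶠ s in 𝓝 (0 : ℝ), (y₀ + E 0) / 2 < E s :=
      hE.continuousAt.eventually (lt_mem_nhds (by linarith [hy₀.2]))
    obtain ⟨d, hd, hball⟩ := Metric.eventually_nhds_iff.1 h1
    have h2 : 0 < (E 0 - y₀) / 2 := by linarith [hy₀.2]
    have := hy₀.1
    refine ⟨min (min (a / 2) (y₀ / 2)) (min (d / 2) ((E 0 - y₀) / 2)), by positivity, ?_, ?_, ?_⟩
    · exact ((min_le_left _ _).trans (min_le_left _ _)).trans_lt (by linarith)
    · exact ((min_le_left _ _).trans (min_le_right _ _)).trans_lt (by linarith)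
    · intro s hs
      have hs1 : |s| ≤ d / 2 := hs.trans ((min_le_right _ _).trans (min_le_left _ _))
      have h3 := hball (y := s) (by rw [Real.dist_eq, sub_zero]; linarith)
      have h4 : min (min (a / 2) (y₀ / 2)) (min (d / 2) ((E 0 - y₀) / 2)) ≤ (E 0 - y₀) / 2 :=
        (min_le_right _ _).trans (min_le_right _ _)
      linarith
  obtain ⟨τ, hτ, hτr, hτ1, hτ2⟩ : ∃ τ > 0, τ ≤ r ∧ τ ≤ 1 ∧ τ ≤ r ^ 2 / 2 := by
    refine ⟨min r (min 1 (r ^ 2 / 2)), by positivity, min_le_left _ _, ?_, ?_⟩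
    · exact (min_le_right _ _).trans (min_le_left _ _)
    · exact (min_le_right _ _).trans (min_le_right _ _)
  set p : ℂ := ⟨0, y₀⟩ with hp
  have hre : ∀ z : ℂ, ((1 : ℂ) * (z - p)).re = z.re := by intro z; simp [hp]
  have him : ∀ z : ℂ, ((1 : ℂ) * (z - p)).im = z.im - y₀ := by intro z; simp [hp]
  have hgeom : ∀ z : ℂ, 0 ≤ z.re → z.re ≤ τ → 1 * (z.im - y₀) ^ 2 ≤ z.re + 1 * z.re ^ 2 →
      z.re < a ∧ 0 < z.im ∧ z.im < E z.re := by
    intro z h1 h2 h3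
    have h4 : (z.im - y₀) ^ 2 ≤ r ^ 2 := by nlinarith
    have h5 := abs_le.1 (abs_le_of_sq_le_sq h4 hr.le)
    have h6 := hrE z.re (by rw [abs_of_nonneg h1]; linarith)
    exact ⟨by linarith, by linarith, by linarith⟩
  obtain ⟨ε, hε, hbound⟩ := exists_hopf_lower_bound (u := u) (p := p) (n := 1) one_ne_zero one_pos hτ
    (hcont.mono fun z hz => by
      simp only [hre, him, mem_ofPred_eq] at hz
      obtain ⟨h1, h2, h3⟩ := hgeom z hz.1 hz.2.1 hz.2.2
      exact ⟨hz.1, h1.le, h2.le, h3.le⟩)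
    (hu.mono fun z hz => by
      simp only [hre, him, mem_ofPred_eq] at hz
      obtain ⟨h1, h2, h3⟩ := hgeom z hz.1.le hz.2.1.le hz.2.2.le
      exact ⟨hz.1, h1, h2, h3⟩)
    (fun z h1 h2 h3 => by
      simp only [hre, him] at h1 h2 h3
      obtain ⟨h4, h5, h6⟩ := hgeom z h1 h2 h3
      exact hnonneg z ⟨h1, h4.le, h5.le, h6.le⟩)
    (fun z h1 h3 => by
      simp only [hre, him] at h1 h3
      obtain ⟨h4, h5, h6⟩ := hgeom z (h1.symm ▸ hτ.le) h1.le h3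
      exact hup z ⟨h1.symm ▸ hτ, h4, h5, h6⟩)
  refine ⟨ε, hε, τ, hτ, ?_⟩
  intro s hs
  have := hbound ⟨s, y₀⟩ (by rw [hre]; exact hs.1) (by rw [hre]; exact hs.2)
    (by rw [hre, him]; simp only [sub_self]; nlinarith [hs.1, sq_nonneg s])
  rw [hre, him] at this
  refine le_trans ?_ this
  simp only [sub_self]
  gcongr
  nlinarith [sq_nonneg s]

-- Hopf's estimate covers the part near the axis; on the rest `u` has a positive minimum by
-- compactness.
include hE hu hcont hnonneg hup in
theorem exists_linear_lower_bound_on_segment (ha : 0 < a) {y₀ b : ℝ} (hy₀ : y₀ ∈ Ioo 0 (E 0))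
    (hb : 0 < b) (hba : b < a) (hseg : ∀ s ∈ Ioc 0 b, y₀ < E s) :
    ∃ c > 0, ∀ s ∈ Icc 0 b, c * s ≤ u ⟨s, y₀⟩ := by
  obtain ⟨ε, hε, δ, hδ, hlow⟩ :=
    exists_linear_lower_bound_beside_axis hE hu hcont hnonneg hup ha hy₀
  rcases le_or_gt b δ with hbδ | hbδ
  · exact ⟨ε, hε, fun s hs => hlow s ⟨hs.1, hs.2.trans hbδ⟩⟩
  have hcell : ∀ s ∈ Icc δ b, (⟨s, y₀⟩ : ℂ) ∈ profileCell a E := fun s hs =>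
    ⟨hδ.trans_le hs.1, hs.2.trans_lt hba, hy₀.1, hseg s ⟨hδ.trans_le hs.1, hs.2⟩⟩
  have hc : ContinuousOn (fun s : ℝ => u ⟨s, y₀⟩) (Icc δ b) := by
    refine hcont.comp (f := fun s : ℝ => (⟨s, y₀⟩ : ℂ)) ?_
      (fun s hs => profileCell_subset_closed (hcell s hs))
    exact (Complex.equivRealProdCLM.symm.continuous.comp
      (continuous_id.prodMk continuous_const)).continuousOn
  obtain ⟨s₁, hs₁, hmin⟩ := isCompact_Icc.exists_isMinOn (nonempty_Icc.2 hbδ.le) hc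
  have hpos₁ := hup _ (hcell s₁ hs₁)
  refine ⟨min ε (u ⟨s₁, y₀⟩ / b), by positivity, fun s hs => ?_⟩
  rcases le_or_gt s δ with h | h
  · exact (mul_le_mul_of_nonneg_right (min_le_left _ _) hs.1).trans (hlow s ⟨hs.1, h⟩)
  · have h1 : u ⟨s₁, y₀⟩ ≤ u ⟨s, y₀⟩ := hmin ⟨h.le, hs.2⟩
    refine le_trans ?_ h1
    calc min ε (u ⟨s₁, y₀⟩ / b) * s ≤ u ⟨s₁, y₀⟩ / b * b :=
          mul_le_mul (min_le_right _ _) hs.2 hs.1 (by positivity)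
      _ = u ⟨s₁, y₀⟩ := div_mul_cancel₀ _ hb.ne'

-- Serrin's barrier, of the form `s t` plus cubic terms, is at least `t²` on the diagonal `s = t`.
-- The quadratic bound has no linear term, which makes the corner a right angle from inside.
include hE hpos hu hcont hnonneg hup in
theorem exists_quadratic_lower_bound_at_corner (ha : 0 < a) {K δ : ℝ} (hK : 0 < K) (hδ : 0 < δ)
    (hquad : ∀ s, |s| < δ → E 0 - K * s ^ 2 ≤ E s) :
    ∃ ε > 0, ∃ τ > 0, ∀ t ∈ Ioo 0 τ, ε * t ^ 2 ≤ u ⟨t, E 0 - t⟩ := by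
  obtain ⟨d, hd, hda, hdδ⟩ : ∃ d > 0, d < a ∧ d < δ := by
    refine ⟨min a δ / 2, by positivity, ?_, ?_⟩
    · have := min_le_left a δ; linarith
    · have := min_le_right a δ; linarith
  -- Since `3 k t² ≤ t`, the conic gives `4 K s² ≤ 2 t`, so the graph drops by at most `t / 2` and
  -- the region stays below it.
  set k : ℝ := 4 * K with hk
  have hkpos : 0 < k := by positivity
  obtain ⟨τ, hτ, t1, t2, t3⟩ : ∃ τ > 0, τ ≤ 1 / (3 * k) ∧ τ ≤ k * d ^ 2 / 2 ∧ τ ≤ E 0 / 2 := by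
    have := hpos 0
    refine ⟨min (1 / (3 * k)) (min (k * d ^ 2 / 2) (E 0 / 2)), by positivity, min_le_left _ _, ?_, ?_⟩
    · exact (min_le_right _ _).trans (min_le_left _ _)
    · exact (min_le_right _ _).trans (min_le_right _ _)
  rw [le_div_iff₀ (by positivity)] at t1
  have hgeom : ∀ s t : ℝ, 0 ≤ s → 0 ≤ t → t ≤ τ → k * s ^ 2 ≤ t + 3 * k * t ^ 2 →
      s ≤ d ∧ E 0 - t / 2 ≤ E s := by
    intro s t hs ht1 ht2 h
    have h1 : 3 * k * t ^ 2 ≤ t := by nlinarith [mul_nonneg hkpos.le ht1]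
    have h2 : k * s ^ 2 ≤ k * d ^ 2 := by linarith
    have h3 : s ≤ d := abs_le_of_sq_le_sq' (le_of_mul_le_mul_left h2 hkpos) hd.le |>.2
    have h4 := hquad s (by rw [abs_of_nonneg hs]; linarith)
    exact ⟨h3, by rw [hk] at h h1; linarith⟩
  have hclosed : ∀ z : ℂ, 0 ≤ z.re → 0 ≤ E 0 - z.im → E 0 - z.im ≤ τ →
      k * z.re ^ 2 ≤ (E 0 - z.im) + 3 * k * (E 0 - z.im) ^ 2 → z ∈ closedProfileCell a E := by
    intro z h1 h2 h3 h4
    obtain ⟨h5, h6⟩ := hgeom _ _ h1 h2 h3 h4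
    exact ⟨h1, by linarith, by linarith [hpos 0], by linarith⟩
  -- Bounds the half-width of the conic region at depth `τ`, where `k s² ≤ τ + 3 k τ² ≤ 2 τ`.
  set b : ℝ := √(2 * τ / k) with hbdef
  have hb : 0 < b := by positivity
  have hb2 : k * b ^ 2 = 2 * τ := by
    rw [hbdef, Real.sq_sqrt (by positivity)]
    field_simp
  have hbd : b ≤ d :=
    (abs_le_of_sq_le_sq' (le_of_mul_le_mul_left (by linarith) hkpos : b ^ 2 ≤ d ^ 2) hd.le).2
  obtain ⟨c, hc, hbot⟩ := exists_linear_lower_bound_on_segment hE hu hcont hnonneg hup ha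
    (y₀ := E 0 - τ) (b := b) ⟨by linarith [hpos 0], by linarith⟩ hb (hbd.trans_lt hda) (by
      intro s hs
      have h1 := hquad s (by rw [abs_of_pos hs.1]; linarith [hs.2])
      have h2 : s ^ 2 ≤ b ^ 2 := by have := hs.1; have := hs.2; gcongr
      have h3 : k * s ^ 2 ≤ k * b ^ 2 := by gcongr
      rw [hk] at h3 hb2
      linarith)
  obtain ⟨ε, hε, hbound⟩ := exists_corner_lower_bound (u := u) (h := E 0) hkpos hτ
    (hcont.mono fun z hz => hclosed z hz.1 hz.2.1 hz.2.2.1 hz.2.2.2)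
    (hu.mono fun z hz => by
      obtain ⟨h5, h6⟩ := hgeom _ _ hz.1.le hz.2.1.le hz.2.2.1.le hz.2.2.2.le
      obtain ⟨h1, h2, h3, -⟩ := hz
      exact ⟨h1, by linarith, by linarith [hpos 0], by linarith⟩)
    (fun z h1 h2 h3 h4 => hnonneg z (hclosed z h1 h2 h3 h4)) hc (by
      intro z h1 h2 h4
      have h5 : 3 * k * τ ^ 2 ≤ τ := by nlinarith
      have h6 : z.re ≤ b :=
        (abs_le_of_sq_le_sq' (le_of_mul_le_mul_left (by linarith) hkpos : z.re ^ 2 ≤ b ^ 2) hb.le).2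
      have h7 : z = ⟨z.re, E 0 - τ⟩ := by
        apply Complex.ext
        · rfl
        · change z.im = E 0 - τ
          linarith
      have h8 := hbot z.re ⟨h1, h6⟩
      rwa [← h7] at h8)
  refine ⟨ε, hε, τ, hτ, fun t ht => ?_⟩
  have ht0 := ht.1
  have hkt : 0 ≤ k * t ^ 2 := by positivity
  have := hbound ⟨t, E 0 - t⟩ ht0.le (by simp [ht0.le]) (by simp [ht.2.le])
    (by simp only [sub_sub_cancel]; linarith)
  simp only [sub_sub_cancel] at this
  refine le_trans ?_ this
  gcongr
  nlinarith [mul_nonneg ht0.le hkt]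

end ProfileCell

/-! ### Regularity of the profile and of the fluid domain. -/

/-- Mean value inequality for `f` minus its linear part: near `x₀` the derivative varies by at most
`K |x - x₀|`. -/
theorem exists_quadratic_lower_bound {f : ℝ → ℝ} {x₀ : ℝ} (hf : Differentiable ℝ f)
    (hf' : DifferentiableAt ℝ (deriv f) x₀) :
    ∃ K > 0, ∃ δ > 0, ∀ x, |x - x₀| < δ →
      f x₀ + deriv f x₀ * (x - x₀) - K * (x - x₀) ^ 2 ≤ f x := by
  obtain ⟨K, hK, hO⟩ := hf'.isBigO_sub.exists_pos
  obtain ⟨δ, hδ, hball⟩ := Metric.eventually_nhds_iff_ball.1 hO.bound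
  refine ⟨K, hK, δ, hδ, fun x hx => ?_⟩
  have hsub : Metric.closedBall x₀ |x - x₀| ⊆ Metric.ball x₀ δ :=
    Metric.closedBall_subset_ball hx
  have hd : ∀ y ∈ Metric.closedBall x₀ |x - x₀|,
      HasDerivWithinAt (fun y => f y - deriv f x₀ * y) (deriv f y - deriv f x₀)
        (Metric.closedBall x₀ |x - x₀|) y := by
    intro y _
    have := (hf y).hasDerivAt.sub ((hasDerivAt_id y).const_mul (deriv f x₀))
    simpa using! this.hasDerivWithinAt
  have hbd : ∀ y ∈ Metric.closedBall x₀ |x - x₀|, ‖deriv f y - deriv f x₀‖ ≤ K * |x - x₀| := by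
    intro y hy
    refine (hball y (hsub hy)).trans ?_
    gcongr
    exact hy
  have := (convex_closedBall x₀ |x - x₀|).norm_image_sub_le_of_norm_hasDerivWithin_le hd hbd
    (Metric.mem_closedBall_self (abs_nonneg _)) (y := x)
    (by rw [Metric.mem_closedBall, Real.dist_eq])
  rw [Real.norm_eq_abs, Real.norm_eq_abs, mul_assoc, abs_mul_abs_self] at this
  have := (abs_le.1 this).1
  linarith

theorem isOpen_fluid {η : ℝ → ℝ} (hη : Continuous η) : IsOpen (fluid η) := by
  refine IsOpen.and ?_ ?_ <;> apply isOpen_lt <;> fun_prop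

theorem fluid_subset_closedFluid {η : ℝ → ℝ} : fluid η ⊆ closedFluid η :=
  fun _ hp => ⟨hp.1.le, hp.2.le⟩

/-- The region is the image of a flat strip under a map with surjective differential, so derivatives
up to the boundary are well defined without convexity. -/
theorem uniqueDiffOn_closedFluid {η : ℝ → ℝ} (hη : Differentiable ℝ η) (hpos : ∀ x, 0 < η x) :
    UniqueDiffOn ℝ (closedFluid η) := by
  have himage : closedFluid η = (fun q : ℝ × ℝ => (q.1, q.2 * η q.1)) '' (univ ×ˢ Icc 0 1) := by
    ext p
    constructor
    · rintro ⟨h1, h2⟩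
      refine ⟨(p.1, p.2 / η p.1),
        ⟨mem_univ _, div_nonneg h1 (hpos _).le, (div_le_one (hpos _)).2 h2⟩, ?_⟩
      exact Prod.ext rfl (div_mul_cancel₀ _ (hpos _).ne')
    · rintro ⟨⟨x, t⟩, ⟨-, h1, h2⟩, rfl⟩
      exact ⟨mul_nonneg h1 (hpos _).le, mul_le_of_le_one_left (hpos _).le h2⟩
  rw [himage]
  refine UniqueDiffOn.image (f' := fun q => (ContinuousLinearMap.fst ℝ ℝ ℝ).prod
    (q.2 • (deriv η q.1) • ContinuousLinearMap.fst ℝ ℝ ℝ + η q.1 • ContinuousLinearMap.snd ℝ ℝ ℝ))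
    (uniqueDiffOn_univ.prod (uniqueDiffOn_Icc zero_lt_one)) ?_ ?_
  · rintro ⟨x, t⟩ -
    apply HasFDerivAt.hasFDerivWithinAt
    refine hasFDerivAt_fst.prodMk ?_
    exact hasFDerivAt_snd.mul ((hη x).hasDerivAt.comp_hasFDerivAt (x, t) hasFDerivAt_fst)
  · rintro ⟨x, t⟩ -
    apply Function.Surjective.denseRange
    rintro ⟨a, b⟩
    have := (hpos x).ne'
    refine ⟨(a, (b - t * (deriv η x * a)) / η x), ?_⟩
    simp
    field_simp
    ring

/-! ### The Laplacian under reflection. -/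

section Laplacian

theorem laplacian_comp_reflected_coordinates {f : ℝ × ℝ → ℝ} {c θ : ℝ} (hθ : θ ^ 2 = 1) {z : ℂ}
    (hf : ContDiffAt ℝ 2 f (c + θ * z.re, z.im)) :
    Laplacian.laplacian (fun z : ℂ => f (c + θ * z.re, z.im)) z =
      fderiv ℝ (fderiv ℝ f) (c + θ * z.re, z.im) (1, 0) (1, 0) +
        fderiv ℝ (fderiv ℝ f) (c + θ * z.re, z.im) (0, 1) (0, 1) := by
  set L : ℂ →L[ℝ] ℝ × ℝ := (θ • Complex.reCLM).prod Complex.imCLM with hL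
  set e : ℂ → ℝ × ℝ := fun z => (c + θ * z.re, z.im) with he
  have hed : ∀ z, HasFDerivAt e L z := by
    intro z
    have h1 : HasFDerivAt (fun z : ℂ => c + θ * z.re) (θ • Complex.reCLM) z := by
      simpa using! (Complex.reCLM.hasFDerivAt.const_smul θ).const_add c
    exact h1.prodMk Complex.imCLM.hasFDerivAt
  have hec : Continuous e := continuous_iff_continuousAt.2 fun z => (hed z).continuousAt
  have hfd : fderiv ℝ (fun z : ℂ => f (e z)) =ᶠ[𝓝 z] fun z => (fderiv ℝ f (e z)).comp L := by
    filter_upwards [hec.continuousAt.eventually (hf.eventually (by simp))] with y hy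
    exact ((hy.differentiableAt two_ne_zero).hasFDerivAt.comp y (hed y)).fderiv
  have hf2 : DifferentiableAt ℝ (fderiv ℝ f) (e z) :=
    (hf.fderiv_right (m := 1) (by norm_num)).differentiableAt one_ne_zero
  have hdd : ∀ v w : ℂ, fderiv ℝ (fderiv ℝ (fun z : ℂ => f (e z))) z v w
      = fderiv ℝ (fderiv ℝ f) (e z) (L v) (L w) := by
    intro v w
    rw [hfd.fderiv_eq]
    have h1 : HasFDerivAt (fun z => (fderiv ℝ f (e z)).comp L) _ z :=
      (hf2.hasFDerivAt.comp z (hed z)).clm_comp (hasFDerivAt_const L z)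
    rw [h1.fderiv]
    simp
  rw [InnerProductSpace.laplacian_eq_iteratedFDeriv_complexPlane]
  simp only [iteratedFDeriv_two_apply]
  simp only [Matrix.cons_val_zero, Matrix.cons_val_one]
  change fderiv ℝ (fderiv ℝ (fun z : ℂ => f (e z))) z 1 1
    + fderiv ℝ (fderiv ℝ (fun z : ℂ => f (e z))) z Complex.I Complex.I = _
  rw [hdd, hdd]
  have e1 : L 1 = θ • (1, 0) := by simp [hL]
  have e2 : L Complex.I = (0, 1) := by simp [hL]
  rw [e1, e2]
  simp only [map_smul, smul_apply, smul_smul]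
  rw [← sq, hθ, one_smul]

end Laplacian

/-! ### Consequences of the free boundary conditions. -/

section Flow

variable {g A B γ Q p₀ : ℝ} {η : ℝ → ℝ} {ψ : ℝ × ℝ → ℝ}

theorem IsPeriodicFlow.differentiable_profile (h : IsPeriodicFlow η ψ) : Differentiable ℝ η :=
  h.profile_contDiff.differentiable one_ne_zero

theorem IsPeriodicFlow.uniqueDiffOn (h : IsPeriodicFlow η ψ) : UniqueDiffOn ℝ (closedFluid η) :=
  uniqueDiffOn_closedFluid h.differentiable_profile h.profile_pos

theorem IsPeriodicFlow.surface_mem (h : IsPeriodicFlow η ψ) (x : ℝ) :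
    (x, η x) ∈ closedFluid η := ⟨(h.profile_pos x).le, le_rfl⟩

theorem IsPeriodicFlow.contDiffOn_fderivWithin (h : IsPeriodicFlow η ψ) :
    ContDiffOn ℝ 1 (fderivWithin ℝ ψ (closedFluid η)) (closedFluid η) :=
  h.contDiffOn.fderivWithin h.uniqueDiffOn (by norm_num)

theorem IsPeriodicFlow.contDiffOn_partialX (h : IsPeriodicFlow η ψ) :
    ContDiffOn ℝ 1 (partialX (closedFluid η) ψ) (closedFluid η) :=
  h.contDiffOn_fderivWithin.clm_apply contDiffOn_const

theorem IsPeriodicFlow.contDiffOn_partialY (h : IsPeriodicFlow η ψ) :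
    ContDiffOn ℝ 1 (partialY (closedFluid η) ψ) (closedFluid η) :=
  h.contDiffOn_fderivWithin.clm_apply contDiffOn_const

theorem IsPeriodicFlow.hasFDerivWithinAt (h : IsPeriodicFlow η ψ) {p : ℝ × ℝ}
    (hp : p ∈ closedFluid η) :
    HasFDerivWithinAt ψ (fderivWithin ℝ ψ (closedFluid η) p) (closedFluid η) p :=
  (h.contDiffOn.differentiableOn two_ne_zero p hp).hasFDerivWithinAt

theorem fderivWithin_apply_eq {s : Set (ℝ × ℝ)} {f : ℝ × ℝ → ℝ} {p : ℝ × ℝ} (a b : ℝ) :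
    fderivWithin ℝ f s p (a, b) = a * partialX s f p + b * partialY s f p := by
  have : ((a, b) : ℝ × ℝ) = a • (1, 0) + b • (0, 1) := by simp
  rw [this, map_add, map_smul, map_smul]
  rfl

theorem IsPeriodicFlow.hasDerivAt_along_surface (h : IsPeriodicFlow η ψ) {f : ℝ × ℝ → ℝ} {x : ℝ}
    (hf : DifferentiableWithinAt ℝ f (closedFluid η) (x, η x)) :
    HasDerivAt (fun x => f (x, η x))
      (partialX (closedFluid η) f (x, η x) + deriv η x * partialY (closedFluid η) f (x, η x)) x := by
  have hc : HasDerivAt (fun x => (x, η x)) (1, deriv η x) x :=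
    (hasDerivAt_id x).prodMk (h.differentiable_profile x).hasDerivAt
  have := hf.hasFDerivWithinAt.comp_hasDerivAt x hc (Eventually.of_forall h.surface_mem)
  rw [fderivWithin_apply_eq, one_mul] at this
  exact this

theorem SolvesStratifiedSystem.partialX_surface (h : IsPeriodicFlow η ψ)
    (hs : SolvesStratifiedSystem g A B γ Q p₀ η ψ) (x : ℝ) :
    partialX (closedFluid η) ψ (x, η x) = -(deriv η x * partialY (closedFluid η) ψ (x, η x)) := by
  have h1 := h.hasDerivAt_along_surface (h.hasFDerivWithinAt (h.surface_mem x)).differentiableWithinAt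
  have h2 : (fun x => ψ (x, η x)) = fun _ => 0 := funext hs.surface
  rw [h2] at h1
  have := h1.unique (hasDerivAt_const x (0 : ℝ))
  linarith

/-- The profile gains a derivative: differentiating `ψ = 0` along the surface gives `η' = -ψ_x /
ψ_y`, a quotient of differentiable traces. -/
theorem SolvesStratifiedSystem.differentiable_deriv_profile (h : IsPeriodicFlow η ψ)
    (hs : SolvesStratifiedSystem g A B γ Q p₀ η ψ)
    (hne : ∀ x, partialY (closedFluid η) ψ (x, η x) ≠ 0) : Differentiable ℝ (deriv η) := by
  have : deriv η = fun x =>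
      -partialX (closedFluid η) ψ (x, η x) / partialY (closedFluid η) ψ (x, η x) := by
    funext x
    rw [hs.partialX_surface h x, neg_neg, mul_div_cancel_right₀ _ (hne x)]
  rw [this]
  intro x
  have hX := h.hasDerivAt_along_surface
    (h.contDiffOn_partialX.differentiableOn one_ne_zero _ (h.surface_mem x))
  have hY := h.hasDerivAt_along_surface
    (h.contDiffOn_partialY.differentiableOn one_ne_zero _ (h.surface_mem x))
  exact (hX.differentiableAt.neg).div hY.differentiableAt (hne x)

theorem IsPeriodicFlow.surface_mem_closure_fluid (h : IsPeriodicFlow η ψ) (x : ℝ) :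
    (x, η x) ∈ closure (fluid η) := by
  have h1 : MapsTo (fun y : ℝ => (x, y)) (Ioo 0 (η x)) (fluid η) := fun y hy => hy
  have h2 : η x ∈ closure (Ioo 0 (η x)) := by
    rw [closure_Ioo (h.profile_pos x).ne]
    exact ⟨(h.profile_pos x).le, le_rfl⟩
  exact map_mem_closure (by fun_prop : Continuous fun y : ℝ => (x, y)) h2 h1

theorem IsPeriodicFlow.partialY_partialX_surface (h : IsPeriodicFlow η ψ) (x : ℝ) :
    partialY (closedFluid η) (partialX (closedFluid η) ψ) (x, η x) =
      partialX (closedFluid η) (partialY (closedFluid η) ψ) (x, η x) := by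
  have hmem := h.surface_mem x
  have hint : (x, η x) ∈ closure (interior (closedFluid η)) :=
    closure_mono (interior_maximal fluid_subset_closedFluid
      (isOpen_fluid h.profile_contDiff.continuous)) (h.surface_mem_closure_fluid x)
  have hsymm : IsSymmSndFDerivWithinAt ℝ ψ (closedFluid η) (x, η x) :=
    (h.contDiffOn _ hmem).isSymmSndFDerivWithinAt (by simp) h.uniqueDiffOn hint hmem
  have hd : DifferentiableWithinAt ℝ (fderivWithin ℝ ψ (closedFluid η)) (closedFluid η) (x, η x) :=
    h.contDiffOn_fderivWithin.differentiableOn one_ne_zero _ hmem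
  have happ : ∀ v w : ℝ × ℝ, fderivWithin ℝ (fun p => fderivWithin ℝ ψ (closedFluid η) p w)
      (closedFluid η) (x, η x) v =
      fderivWithin ℝ (fderivWithin ℝ ψ (closedFluid η)) (closedFluid η) (x, η x) v w := by
    intro v w
    rw [fderivWithin_clm_apply (h.uniqueDiffOn _ hmem) hd (differentiableWithinAt_const w)]
    simp
  exact (happ (0, 1) (1, 0)).trans ((hsymm (0, 1) (1, 0)).trans (happ (1, 0) (0, 1)).symm)

/-- Where `η' = 0`, also `ψ_x = 0`, and Bernoulli's law differentiated along the surface reduces to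
`2 ψ_y ψ_xy = 0`. -/
theorem SolvesStratifiedSystem.partialY_partialX_eq_zero (h : IsPeriodicFlow η ψ)
    (hs : SolvesStratifiedSystem g A B γ Q p₀ η ψ) {x : ℝ}
    (hne : partialY (closedFluid η) ψ (x, η x) ≠ 0) (hx : deriv η x = 0) :
    partialY (closedFluid η) (partialX (closedFluid η) ψ) (x, η x) = 0 := by
  rw [h.partialY_partialX_surface]
  have hX := h.hasDerivAt_along_surface
    (h.contDiffOn_partialX.differentiableOn one_ne_zero _ (h.surface_mem x))
  have hY := h.hasDerivAt_along_surface
    (h.contDiffOn_partialY.differentiableOn one_ne_zero _ (h.surface_mem x))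
  have hsum := ((hX.pow 2).add (hY.pow 2)).add
    ((h.differentiable_profile x).hasDerivAt.const_mul (2 * g * B))
  have hconst : HasDerivAt (fun _ : ℝ => Q) 0 x := hasDerivAt_const x Q
  have := hsum.unique (hconst.congr_of_eventuallyEq (Eventually.of_forall fun y => hs.bernoulli y))
  rw [hs.partialX_surface h x, hx] at this
  simpa [hne] using this

/-- Since `ψ_x` and `ψ_xy` vanish at the surface point, `ψ_x` is `s ψ_xx + o(t)` nearby. The terms
linear in `s` cancel between the two sides, leaving `o(t)` to integrate over a length `t`. -/
theorem SolvesStratifiedSystem.reflected_difference_isLittleO (h : IsPeriodicFlow η ψ)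
    (hs : SolvesStratifiedSystem g A B γ Q p₀ η ψ)
    (hne : ∀ x, partialY (closedFluid η) ψ (x, η x) ≠ 0) {x₀ : ℝ} (hx₀ : deriv η x₀ = 0)
    {ε : ℝ} (hε : 0 < ε) :
    ∃ τ > 0, ∀ t ∈ Ioo 0 τ, |ψ (x₀ + t, η x₀ - t) - ψ (x₀ - t, η x₀ - t)| ≤ ε * t ^ 2 := by
  obtain ⟨K, hK, δ, hδ, hquad⟩ := exists_quadratic_lower_bound h.differentiable_profile
    (hs.differentiable_deriv_profile h hne x₀)
  have hD := (h.contDiffOn_partialX.differentiableOn one_ne_zero _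
    (h.surface_mem x₀)).hasFDerivWithinAt
  have hO := hD.isLittleO.def (half_pos hε)
  rw [eventually_nhdsWithin_iff] at hO
  obtain ⟨r, hr, hball⟩ := Metric.eventually_nhds_iff.1 hO
  have hzero : partialX (closedFluid η) ψ (x₀, η x₀) = 0 := by
    rw [hs.partialX_surface h, hx₀]; simp
  have hyx := hs.partialY_partialX_eq_zero h (hne x₀) hx₀
  have hηpos := h.profile_pos x₀
  refine ⟨min (min r (1 / K)) (min δ (η x₀)), by positivity, fun t ht => ?_⟩
  have ht0 := ht.1
  have htr : t < r := ht.2.trans_le ((min_le_left _ _).trans (min_le_left _ _))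
  have htK : t < 1 / K := ht.2.trans_le ((min_le_left _ _).trans (min_le_right _ _))
  have htδ : t < δ := ht.2.trans_le ((min_le_right _ _).trans (min_le_left _ _))
  have htη : t < η x₀ := ht.2.trans_le ((min_le_right _ _).trans (min_le_right _ _))
  rw [lt_div_iff₀ hK] at htK
  have hmem : ∀ s, |s| ≤ t → (x₀ + s, η x₀ - t) ∈ closedFluid η := by
    intro s hs'
    refine ⟨by simp only; linarith, ?_⟩
    have h1 := hquad (x₀ + s) (by simpa using hs'.trans_lt htδ)
    rw [hx₀] at h1
    simp only [add_sub_cancel_left] at h1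
    have h2 : s ^ 2 ≤ t ^ 2 := sq_le_sq' (abs_le.1 hs').1 (abs_le.1 hs').2
    simp only
    nlinarith
  have hbound : ∀ s, |s| ≤ t → |partialX (closedFluid η) ψ (x₀ + s, η x₀ - t)
      - s * partialX (closedFluid η) (partialX (closedFluid η) ψ) (x₀, η x₀)| ≤ ε / 2 * t := by
    intro s hs'
    have hsub : ((x₀ + s, η x₀ - t) : ℝ × ℝ) - (x₀, η x₀) = (s, -t) := by simp
    have hnorm : ‖((s, -t) : ℝ × ℝ)‖ ≤ t := by
      rw [Prod.norm_mk]
      simp [hs', abs_of_pos ht0]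
    have := hball (y := (x₀ + s, η x₀ - t))
      (by rw [dist_eq_norm, hsub]; exact hnorm.trans_lt htr) (hmem s hs')
    rw [hsub, fderivWithin_apply_eq, hzero, hyx, mul_zero, add_zero, sub_zero] at this
    exact this.trans (by gcongr)
  have hderiv : ∀ c : ℝ, |c| = 1 → ∀ s ∈ Icc 0 t,
      HasDerivWithinAt (fun s => ψ (x₀ + c * s, η x₀ - t))
        (c * partialX (closedFluid η) ψ (x₀ + c * s, η x₀ - t)) (Icc 0 t) s := by
    intro c hc s hs'
    have hm : ∀ s ∈ Icc 0 t, (x₀ + c * s, η x₀ - t) ∈ closedFluid η := fun s hs' =>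
      hmem (c * s) (by rw [abs_mul, hc, one_mul, abs_of_nonneg hs'.1]; exact hs'.2)
    have h1 : HasDerivAt (fun s => (x₀ + c * s, η x₀ - t)) (c, 0) s := by
      refine HasDerivAt.prodMk ?_ (hasDerivAt_const _ _)
      simpa using ((hasDerivAt_id s).const_mul c).const_add x₀
    have := (h.hasFDerivWithinAt (hm s hs')).comp_hasDerivWithinAt s h1.hasDerivWithinAt hm
    rw [fderivWithin_apply_eq, zero_mul, add_zero] at this
    exact this
  have key := norm_image_sub_le_of_norm_deriv_le_segment' (a := 0) (b := t) (C := ε * t)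
    (f := fun s => ψ (x₀ + 1 * s, η x₀ - t) - ψ (x₀ + (-1) * s, η x₀ - t))
    (fun s hs' => (hderiv 1 (by simp) s hs').sub (hderiv (-1) (by simp) s hs')) (by
      intro s hs'
      have h1 := abs_le.1 (hbound (1 * s) (by rw [one_mul, abs_of_nonneg hs'.1]; exact hs'.2.le))
      have h2 := abs_le.1 (hbound ((-1) * s)
        (by rw [neg_one_mul, abs_neg, abs_of_nonneg hs'.1]; exact hs'.2.le))
      rw [Real.norm_eq_abs, abs_le]
      constructor <;> linarith [h1.1, h1.2, h2.1, h2.2]) t ⟨ht0.le, le_rfl⟩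
  simp only [mul_zero, add_zero, sub_self, sub_zero, Real.norm_eq_abs] at key
  rw [one_mul, neg_one_mul, ← sub_eq_add_neg] at key
  linarith

theorem IsPeriodicFlow.hasDerivWithinAt_vertical (h : IsPeriodicFlow η ψ) {x y : ℝ}
    (hy : y ∈ Icc 0 (η x)) :
    HasDerivWithinAt (fun y => ψ (x, y)) (partialY (closedFluid η) ψ (x, y)) (Icc 0 (η x)) y := by
  have h1 : HasDerivAt (fun y => (x, y)) ((0, 1) : ℝ × ℝ) y :=
    (hasDerivAt_const _ _).prodMk (hasDerivAt_id y)
  exact (h.hasFDerivWithinAt (p := (x, y)) hy).comp_hasDerivWithinAt y h1.hasDerivWithinAt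
    fun y hy => hy

/-- Reflection preserves both the Laplacian and the height, so the source `γ - A g y` cancels in the
difference. -/
theorem SolvesStratifiedSystem.harmonicAt_reflected_difference (h : IsPeriodicFlow η ψ)
    (hs : SolvesStratifiedSystem g A B γ Q p₀ η ψ) {c θ : ℝ} (hθ : θ ^ 2 = 1) {z : ℂ}
    (h1 : (c - θ * z.re, z.im) ∈ fluid η) (h2 : (c + θ * z.re, z.im) ∈ fluid η) :
    InnerProductSpace.HarmonicAt
      ((fun z : ℂ => ψ (c - θ * z.re, z.im)) - fun z : ℂ => ψ (c + θ * z.re, z.im)) z := by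
  have hopen := isOpen_fluid h.profile_contDiff.continuous
  have hnhds : ∀ p ∈ fluid η, closedFluid η ∈ 𝓝 p := fun p hp =>
    mem_of_superset (hopen.mem_nhds hp) fluid_subset_closedFluid
  have hC : ∀ p ∈ fluid η, ContDiffAt ℝ 2 ψ p := fun p hp =>
    h.contDiffOn.contDiffAt (hnhds p hp)
  have hsecond : ∀ v : ℝ × ℝ, ∀ p ∈ fluid η,
      fderivWithin ℝ (fun q => fderivWithin ℝ ψ (closedFluid η) q v) (closedFluid η) p v =
        fderiv ℝ (fderiv ℝ ψ) p v v := by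
    intro v p hp
    rw [fderivWithin_of_mem_nhds (hnhds p hp)]
    have he : (fun q => fderivWithin ℝ ψ (closedFluid η) q v) =ᶠ[𝓝 p] fun q => fderiv ℝ ψ q v := by
      filter_upwards [hopen.mem_nhds hp] with q hq
      rw [fderivWithin_of_mem_nhds (hnhds q hq)]
    rw [he.fderiv_eq, fderiv_clm_apply
      (((hC p hp).fderiv_right (m := 1) (by norm_num)).differentiableAt one_ne_zero)
      (differentiableAt_const v)]
    simp
  have hlap : ∀ p ∈ fluid η, fderiv ℝ (fderiv ℝ ψ) p (1, 0) (1, 0)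
      + fderiv ℝ (fderiv ℝ ψ) p (0, 1) (0, 1) = γ - A * g * p.2 := by
    intro p hp
    have := hs.field p.1 p.2 hp
    rw [← hsecond _ p hp, ← hsecond _ p hp]
    change partialX (closedFluid η) (partialX (closedFluid η) ψ) p
      + partialY (closedFluid η) (partialY (closedFluid η) ψ) p = _
    rw [← this]
    simp
  have hev : ∀ θ : ℝ, (c + θ * z.re, z.im) ∈ fluid η →
      ∀ᶠ y : ℂ in 𝓝 z, (c + θ * y.re, y.im) ∈ fluid η := by
    intro θ h
    exact (by fun_prop : Continuous fun y : ℂ => (c + θ * y.re, y.im)).continuousAt.eventually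
      (hopen.mem_nhds h)
  have hCD : ∀ θ : ℝ, ∀ y : ℂ, (c + θ * y.re, y.im) ∈ fluid η →
      ContDiffAt ℝ 2 (fun y : ℂ => ψ (c + θ * y.re, y.im)) y := by
    intro θ y hy
    have h1 : ContDiff ℝ 2 fun y : ℂ => (c + θ * y.re, y.im) := by
      refine ContDiff.prodMk ?_ Complex.imCLM.contDiff
      exact contDiff_const.add (contDiff_const.mul Complex.reCLM.contDiff)
    exact (hC _ hy).comp y h1.contDiffAt
  have hneg : (fun z : ℂ => ψ (c - θ * z.re, z.im)) = fun z : ℂ => ψ (c + (-θ) * z.re, z.im) := by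
    funext z; rw [neg_mul, sub_eq_add_neg]
  rw [sub_eq_add_neg, ← neg_mul] at h1
  rw [hneg]
  refine ⟨(hCD _ z h1).sub (hCD _ z h2), ?_⟩
  filter_upwards [hev _ h1, hev _ h2] with y hy1 hy2
  rw [(hCD _ y hy1).laplacian_sub (hCD _ y hy2),
    laplacian_comp_reflected_coordinates (by rw [neg_sq, hθ]) (hC _ hy1),
    laplacian_comp_reflected_coordinates hθ (hC _ hy2), hlap _ hy1, hlap _ hy2]
  simp

/-- Above a level that bounds all critical points of the vertical profiles, `ψ_y` has a constant
sign. -/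
theorem IsPeriodicFlow.exists_sign_partialY (h : IsPeriodicFlow η ψ) {m : ℝ} (hm : 0 ≤ m)
    (hmη : ∀ x, m ≤ η x)
    (hne : ∀ x y, m ≤ y → y ≤ η x → partialY (closedFluid η) ψ (x, y) ≠ 0) :
    ∃ σ : ℝ, σ ^ 2 = 1 ∧ ∀ x y, m ≤ y → y ≤ η x → 0 < σ * partialY (closedFluid η) ψ (x, y) := by
  set T : Set (ℝ × ℝ) := {p | m ≤ p.2 ∧ p.2 ≤ η p.1} with hT
  have hTS : T ⊆ closedFluid η := fun p hp => ⟨hm.trans hp.1, hp.2⟩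
  -- Clamping the height presents `T` as a continuous image of the plane, even where the fibre
  -- shrinks to a point at trough level.
  have himage : T = (fun q : ℝ × ℝ => (q.1, m + max 0 (min q.2 (η q.1 - m)))) '' univ := by
    ext p
    constructor
    · rintro ⟨h1, h2⟩
      refine ⟨(p.1, p.2 - m), mem_univ _, Prod.ext rfl ?_⟩
      simp only
      rw [min_eq_left (by linarith), max_eq_right (by linarith)]
      ring
    · rintro ⟨q, -, rfl⟩
      have h1 : 0 ≤ η q.1 - m := sub_nonneg.2 (hmη _)
      have h2 : max 0 (min q.2 (η q.1 - m)) ≤ η q.1 - m := max_le h1 (min_le_right _ _)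
      exact ⟨by simp, by simp only; linarith⟩
  have hη := h.profile_contDiff.continuous
  have hpre : IsPreconnected T := by
    rw [himage]
    exact isPreconnected_univ.image _ (by fun_prop : Continuous _).continuousOn
  have hcont : ContinuousOn (partialY (closedFluid η) ψ) T :=
    h.contDiffOn_partialY.continuousOn.mono hTS
  by_cases hcase : ∃ p ∈ T, 0 < partialY (closedFluid η) ψ p
  · obtain ⟨p, hp, hpos⟩ := hcase
    refine ⟨1, by norm_num, fun x y h1 h2 => ?_⟩
    rw [one_mul]
    by_contra! hle
    obtain ⟨q, hq, hq0⟩ := hpre.intermediate_value (show (x, y) ∈ T from ⟨h1, h2⟩) hp hcont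
      ⟨hle, hpos.le⟩
    exact hne q.1 q.2 hq.1 hq.2 hq0
  · push Not at hcase
    refine ⟨-1, by norm_num, fun x y h1 h2 => ?_⟩
    have := lt_of_le_of_ne (hcase (x, y) ⟨h1, h2⟩) (hne x y h1 h2)
    linarith

/-- `σ ψ` increases strictly with height and reaches zero at the surface. -/
theorem SolvesStratifiedSystem.sign_mul_lt_zero (h : IsPeriodicFlow η ψ)
    (hs : SolvesStratifiedSystem g A B γ Q p₀ η ψ) {m σ : ℝ} (hm : 0 ≤ m)
    (hσ : ∀ x y, m ≤ y → y ≤ η x → 0 < σ * partialY (closedFluid η) ψ (x, y)) {x y : ℝ}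
    (hy : m ≤ y) (hyη : y < η x) : σ * ψ (x, y) < 0 := by
  have hsub : Icc y (η x) ⊆ Icc 0 (η x) := Icc_subset_Icc_left (hm.trans hy)
  have hd : ∀ t ∈ Icc y (η x), HasDerivWithinAt (fun t => σ * ψ (x, t))
      (σ * partialY (closedFluid η) ψ (x, t)) (Icc y (η x)) t := fun t ht =>
    ((h.hasDerivWithinAt_vertical (hsub ht)).mono hsub).const_mul σ
  have hmono : StrictMonoOn (fun t => σ * ψ (x, t)) (Icc y (η x)) := by
    refine strictMonoOn_of_deriv_pos (convex_Icc _ _) (fun t ht => (hd t ht).continuousWithinAt) ?_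
    intro t ht
    have htI := interior_subset ht
    rw [((hd t htI).hasDerivAt (mem_interior_iff_mem_nhds.1 ht)).deriv]
    exact hσ x t (hy.trans htI.1) htI.2
  have := hmono ⟨le_rfl, hyη.le⟩ ⟨hyη.le, le_rfl⟩ hyη
  simpa [hs.surface] using this

end Flow

/-! ### Comparison with the reflected flow. -/

section Reflection

variable {g A B γ Q p₀ : ℝ} {η : ℝ → ℝ} {ψ : ℝ × ℝ → ℝ}

/-- If the reflection of the profile across `x = c` lies above the profile on half a period, and
touches it at an interior point or the profile is horizontal on the axis, then the flow is symmetric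
on that half period. -/
theorem SolvesStratifiedSystem.eq_reflection_of_touching (h : IsPeriodicFlow η ψ)
    (hs : SolvesStratifiedSystem g A B γ Q p₀ η ψ) {m σ : ℝ} (hm : 0 ≤ m) (hmη : ∀ x, m ≤ η x)
    (hσ1 : σ ^ 2 = 1)
    (hσ : ∀ x y, m ≤ y → y ≤ η x → 0 < σ * partialY (closedFluid η) ψ (x, y))
    {c θ : ℝ} (hθ : θ ^ 2 = 1)
    (hle : ∀ s ∈ Icc 0 Real.pi, η (c - θ * s) ≤ η (c + θ * s))
    (htouch : (∃ s ∈ Ioo 0 Real.pi, η (c - θ * s) = η (c + θ * s)) ∨ deriv η c = 0) :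
    ∀ s ∈ Icc 0 Real.pi, ∀ y, 0 ≤ y → y ≤ η (c - θ * s) →
      ψ (c - θ * s, y) = ψ (c + θ * s, y) := by
  have hηd := h.differentiable_profile
  have hηc := hηd.continuous
  have hσabs : |σ| = 1 := by
    rw [← sq_eq_sq₀ (abs_nonneg _) zero_le_one, sq_abs, hσ1, one_pow]
  have hσ0 : σ ≠ 0 := by rintro rfl; norm_num at hσ1
  have hneY : ∀ x, partialY (closedFluid η) ψ (x, η x) ≠ 0 := fun x h0 => by
    have := hσ x (η x) (hmη x) le_rfl
    rw [h0, mul_zero] at this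
    exact lt_irrefl _ this
  set E : ℝ → ℝ := fun s => η (c - θ * s) with hE
  have hEc : Continuous E := by fun_prop
  have hEpos : ∀ s, 0 < E s := fun s => h.profile_pos _
  set u : ℂ → ℝ := σ • ((fun z : ℂ => ψ (c - θ * z.re, z.im)) - fun z : ℂ => ψ (c + θ * z.re, z.im))
    with hu
  have huz : ∀ z, u z = σ * (ψ (c - θ * z.re, z.im) - ψ (c + θ * z.re, z.im)) := fun z => rfl
  have hmem1 : ∀ z ∈ closedProfileCell Real.pi E, (c - θ * z.re, z.im) ∈ closedFluid η :=
    fun z hz => ⟨hz.2.2.1, hz.2.2.2⟩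
  have hmem2 : ∀ z ∈ closedProfileCell Real.pi E, (c + θ * z.re, z.im) ∈ closedFluid η :=
    fun z hz => ⟨hz.2.2.1, hz.2.2.2.trans (hle _ ⟨hz.1, hz.2.1⟩)⟩
  have hharm : InnerProductSpace.HarmonicOnNhd u (profileCell Real.pi E) := fun z hz =>
    (hs.harmonicAt_reflected_difference h hθ ⟨hz.2.2.1, hz.2.2.2⟩
      ⟨hz.2.2.1, hz.2.2.2.trans_le (hle _ ⟨hz.1.le, hz.2.1.le⟩)⟩).const_smul
  have hcont : ContinuousOn u (closedProfileCell Real.pi E) := by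
    have hψ := h.contDiffOn.continuousOn
    refine ContinuousOn.const_smul (ContinuousOn.sub ?_ ?_) σ
    · exact hψ.comp (by fun_prop : Continuous fun z : ℂ => (c - θ * z.re, z.im)).continuousOn hmem1
    · exact hψ.comp (by fun_prop : Continuous fun z : ℂ => (c + θ * z.re, z.im)).continuousOn hmem2
  have hbdry : ∀ z ∈ closedProfileCell Real.pi E, z ∉ profileCell Real.pi E → 0 ≤ u z := by
    intro z hz hzn
    rw [huz]
    have hm1 := hmem1 z hz
    have hm2 := hmem2 z hz
    obtain ⟨h1, h2, h3, h4⟩ := hz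
    rcases h1.eq_or_lt with h0 | h1
    · rw [← h0]; simp
    rcases h2.eq_or_lt with h0 | h2
    · suffices ψ (c - θ * z.re, z.im) = ψ (c + θ * z.re, z.im) by rw [this]; simp
      -- Half a period from the axis, the two mirror points differ by a full period.
      rw [h0] at hm1 hm2 ⊢
      rcases mul_self_eq_one_iff.1 ((sq θ).symm.trans hθ) with rfl | rfl
      · rw [← h.periodic _ _ hm1]; congr 2; ring
      · rw [← h.periodic _ _ hm2]; congr 2; ring
    rcases h3.eq_or_lt with h0 | h3
    · rw [← h0, hs.bed, hs.bed]; simp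
    rcases h4.eq_or_lt with h0 | h4
    · have e1 : ψ (c - θ * z.re, z.im) = 0 := by rw [h0]; exact hs.surface _
      rw [e1, zero_sub, mul_neg, neg_nonneg]
      rcases hm2.2.eq_or_lt with h5 | h5
      · simp only at h5
        rw [h5, hs.surface, mul_zero]
      · exact (hs.sign_mul_lt_zero h hm hσ (by rw [h0]; exact hmη _) h5).le
    · exact absurd ⟨h1, h2, h3, h4⟩ hzn
  obtain ⟨hnonneg, hup | hzero⟩ := nonneg_and_pos_or_zero_of_boundary_nonneg Real.pi_pos hEc hEpos
    hharm hcont hbdry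
  swap
  · intro s hs' y hy0 hy1
    have := hzero ⟨s, y⟩ ⟨hs'.1, hs'.2, hy0, hy1⟩
    rw [huz] at this
    exact sub_eq_zero.1 ((mul_eq_zero.1 this).resolve_left hσ0)
  exfalso
  rcases htouch with ⟨s₀, hs₀, heq⟩ | hcrest
  · obtain ⟨K, hK, δ, hδ, hquad⟩ := exists_quadratic_lower_bound hηd
      (hs.differentiable_deriv_profile h hneY (c - θ * s₀))
    obtain ⟨ε, hε, τ, hτ, hlow⟩ := exists_linear_lower_bound_below_top hEpos hharm hcont hnonneg hup
      (m := -(θ * deriv η (c - θ * s₀))) hs₀ hK hδ (by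
        intro s hs'
        have e : c - θ * s - (c - θ * s₀) = -(θ * (s - s₀)) := by ring
        have := hquad (c - θ * s) (by
          rw [e, abs_neg, abs_mul]
          have : |θ| = 1 := by
            rw [← sq_eq_sq₀ (abs_nonneg _) zero_le_one, sq_abs, hθ, one_pow]
          rwa [this, one_mul])
        rw [e, neg_sq, mul_pow, hθ, one_mul] at this
        simp only [hE]
        linarith)
    -- The gap between the profiles is nonnegative and vanishes at `s₀`, so its derivative vanishes
    -- there.
    have hslope : deriv η (c + θ * s₀) = -deriv η (c - θ * s₀) := by
      have hmin : IsLocalMin (fun s => η (c + θ * s) - η (c - θ * s)) s₀ := by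
        filter_upwards [Icc_mem_nhds hs₀.1 hs₀.2] with s hs'
        rw [heq, sub_self]
        exact sub_nonneg.2 (hle s hs')
      have d1 : HasDerivAt (fun s => c + θ * s) θ s₀ := by
        simpa using ((hasDerivAt_id s₀).const_mul θ).const_add c
      have d2 : HasDerivAt (fun s => c - θ * s) (-θ) s₀ := by
        simpa using ((hasDerivAt_id s₀).const_mul θ).const_sub c
      have := hmin.hasDerivAt_eq_zero
        (((hηd _).hasDerivAt.comp s₀ d1).sub ((hηd _).hasDerivAt.comp s₀ d2))
      have hθ0 : θ ≠ 0 := by rintro rfl; norm_num at hθ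
      have h2 : θ * (deriv η (c + θ * s₀) + deriv η (c - θ * s₀)) = 0 := by linarith
      have := (mul_eq_zero.1 h2).resolve_left hθ0
      linarith
    set x₁ := c - θ * s₀ with hx₁
    set x₂ := c + θ * s₀ with hx₂
    -- On the surface Bernoulli's law reads `(1 + η'²) ψ_y² + 2 g B η = Q`. Equal heights and
    -- opposite slopes give equal `ψ_y²`, and the common sign `σ` gives equal `ψ_y`.
    have hY : partialY (closedFluid η) ψ (x₁, η x₁) = partialY (closedFluid η) ψ (x₂, η x₂) := by
      have b1 := hs.bernoulli x₁
      have b2 := hs.bernoulli x₂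
      rw [hs.partialX_surface h] at b1 b2
      rw [hslope] at b2
      have p1 := hσ x₁ (η x₁) (hmη _) le_rfl
      have p2 := hσ x₂ (η x₂) (hmη _) le_rfl
      rw [heq] at b1 p1 ⊢
      set Y₁ := partialY (closedFluid η) ψ (x₁, η x₂)
      set Y₂ := partialY (closedFluid η) ψ (x₂, η x₂)
      have e : (1 + deriv η x₁ ^ 2) * (Y₁ ^ 2 - Y₂ ^ 2) = 0 := by linarith
      have hpos : 1 + deriv η x₁ ^ 2 ≠ 0 := by positivity
      have e2 := (mul_eq_zero.1 e).resolve_left hpos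
      have e3 : (σ * Y₁) ^ 2 = (σ * Y₂) ^ 2 := by rw [mul_pow, mul_pow]; linarith [congrArg (σ ^ 2 * ·) e2]
      exact mul_left_cancel₀ hσ0 ((sq_eq_sq₀ p1.le p2.le).1 e3)
    have hv1 := h.hasDerivWithinAt_vertical (x := x₁) (y := η x₁) ⟨(h.profile_pos _).le, le_rfl⟩
    have hv2 := h.hasDerivWithinAt_vertical (x := x₂) (y := η x₂) ⟨(h.profile_pos _).le, le_rfl⟩
    rw [heq] at hv1 hY
    have hv := hv1.sub hv2
    rw [hY, sub_self] at hv
    have hO := hv.hasFDerivWithinAt.isLittleO.def (half_pos hε)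
    rw [eventually_nhdsWithin_iff] at hO
    obtain ⟨r, hr, hball⟩ := Metric.eventually_nhds_iff.1 hO
    have hη2 := h.profile_pos x₂
    set t := min (min r τ) (η x₂) / 2 with ht
    have htpos : 0 < t := by positivity
    have htr : t < r := by
      have : min (min r τ) (η x₂) ≤ r := (min_le_left _ _).trans (min_le_left _ _)
      linarith
    have htτ : t < τ := by
      have : min (min r τ) (η x₂) ≤ τ := (min_le_left _ _).trans (min_le_right _ _)
      linarith
    have htη : t < η x₂ := by
      have : min (min r τ) (η x₂) ≤ η x₂ := min_le_right _ _
      linarith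
    have hsmall := hball (y := η x₂ - t) (by simpa [abs_of_pos htpos] using htr)
      ⟨by linarith, by linarith⟩
    have hbig := hlow t ⟨htpos, htτ⟩
    rw [huz] at hbig
    change ε * t ≤ σ * (ψ (x₁, η x₁ - t) - ψ (x₂, η x₁ - t)) at hbig
    rw [heq] at hbig
    have e1 : ψ (x₁, η x₂) = 0 := by rw [← heq]; exact hs.surface _
    simp [e1, hs.surface, abs_of_pos htpos] at hsmall
    have := le_abs_self (σ * (ψ (x₁, η x₂ - t) - ψ (x₂, η x₂ - t)))
    rw [abs_mul, hσabs, one_mul] at this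
    nlinarith
  · obtain ⟨K, hK, δ, hδ, hquad⟩ := exists_quadratic_lower_bound hηd
      (hs.differentiable_deriv_profile h hneY c)
    have hθabs : |θ| = 1 := by
      rw [← sq_eq_sq₀ (abs_nonneg _) zero_le_one, sq_abs, hθ, one_pow]
    have hE0 : E 0 = η c := by simp [hE]
    obtain ⟨ε, hε, τ, hτ, hlow⟩ := exists_quadratic_lower_bound_at_corner hEc hEpos hharm hcont
      hnonneg hup Real.pi_pos hK hδ (by
        intro s hs'
        have e : c - θ * s - c = -(θ * s) := by ring
        have := hquad (c - θ * s) (by rwa [e, abs_neg, abs_mul, hθabs, one_mul])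
        rw [e, neg_sq, mul_pow, hθ, one_mul, hcrest] at this
        rw [hE0]
        simp only [hE]
        linarith)
    obtain ⟨τ', hτ', hsmall⟩ := hs.reflected_difference_isLittleO h hneY hcrest (half_pos hε)
    set t := min τ τ' / 2 with ht
    have htpos : 0 < t := by positivity
    have htτ : t < τ := by have := min_le_left τ τ'; linarith
    have htτ' : t < τ' := by have := min_le_right τ τ'; linarith
    have hbig := hlow t ⟨htpos, htτ⟩
    have hsm := hsmall t ⟨htpos, htτ'⟩
    rw [huz, hE0] at hbig
    change ε * t ^ 2 ≤ σ * (ψ (c - θ * t, η c - t) - ψ (c + θ * t, η c - t)) at hbig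
    have habs : |ψ (c - θ * t, η c - t) - ψ (c + θ * t, η c - t)| ≤ ε / 2 * t ^ 2 := by
      rcases mul_self_eq_one_iff.1 ((sq θ).symm.trans hθ) with rfl | rfl
      · rw [abs_sub_comm, one_mul]; exact hsm
      · rw [neg_one_mul, sub_neg_eq_add, ← sub_eq_add_neg]; exact hsm
    have := le_abs_self (σ * (ψ (c - θ * t, η c - t) - ψ (c + θ * t, η c - t)))
    rw [abs_mul, hσabs, one_mul] at this
    nlinarith [pow_pos htpos 2]

/-- The flow is symmetric about the line `x = c`. -/
def IsSymmetricAbout (η : ℝ → ℝ) (ψ : ℝ × ℝ → ℝ) (c : ℝ) : Prop :=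
  ∀ x y, (x, y) ∈ closedFluid η →
    (2 * c - x, y) ∈ closedFluid η ∧ ψ (2 * c - x, y) = ψ (x, y)

theorem IsSymmetricAbout.profile_eq {c : ℝ} (hpos : ∀ x, 0 < η x) (h : IsSymmetricAbout η ψ c)
    (x : ℝ) : η (2 * c - x) = η x := by
  have key : ∀ x, η x ≤ η (2 * c - x) := fun x => (h x (η x) ⟨(hpos x).le, le_rfl⟩).1.2
  refine le_antisymm ?_ (key x)
  simpa using key (2 * c - x)

theorem IsPeriodicFlow.isSymmetricAbout_of_half_period (h : IsPeriodicFlow η ψ) {c θ : ℝ}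
    (hθ : θ ^ 2 = 1) (hη : ∀ s ∈ Icc 0 Real.pi, η (c - θ * s) = η (c + θ * s))
    (hψ : ∀ s ∈ Icc 0 Real.pi, ∀ y, 0 ≤ y → y ≤ η (c - θ * s) →
      ψ (c - θ * s, y) = ψ (c + θ * s, y)) : IsSymmetricAbout η ψ c := by
  have hη' : ∀ s, |s| ≤ Real.pi → η (c - s) = η (c + s) := by
    have key : ∀ s, |s| ≤ Real.pi → η (c - θ * s) = η (c + θ * s) := by
      intro s hs
      rcases le_total 0 s with h0 | h0
      · exact hη s ⟨h0, by rwa [abs_of_nonneg h0] at hs⟩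
      · have := hη (-s) ⟨by linarith, by rwa [abs_of_nonpos h0] at hs⟩
        rw [mul_neg, sub_neg_eq_add, ← sub_eq_add_neg] at this
        exact this.symm
    intro s hs
    rcases mul_self_eq_one_iff.1 ((sq θ).symm.trans hθ) with rfl | rfl
    · simpa using key s hs
    · simpa using key (-s) (by rwa [abs_neg])
  have hψ' : ∀ s, |s| ≤ Real.pi → ∀ y, 0 ≤ y → y ≤ η (c - s) → ψ (c - s, y) = ψ (c + s, y) := by
    have key : ∀ s, |s| ≤ Real.pi → ∀ y, 0 ≤ y → y ≤ η (c - θ * s) →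
        ψ (c - θ * s, y) = ψ (c + θ * s, y) := by
      intro s hs y hy0 hy1
      rcases le_total 0 s with h0 | h0
      · exact hψ s ⟨h0, by rwa [abs_of_nonneg h0] at hs⟩ y hy0 hy1
      · have h1 : -s ∈ Icc 0 Real.pi := ⟨by linarith, by rwa [abs_of_nonpos h0] at hs⟩
        have e := hη (-s) h1
        have := hψ (-s) h1 y hy0
        rw [mul_neg, sub_neg_eq_add, ← sub_eq_add_neg] at this e
        exact (this (e ▸ hy1)).symm
    intro s hs y hy0 hy1
    rcases mul_self_eq_one_iff.1 ((sq θ).symm.trans hθ) with rfl | rfl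
    · simpa using key s hs y hy0 (by simpa using hy1)
    · simpa using key (-s) (by rwa [abs_neg]) y hy0 (by simpa using hy1)
  have hper : ∀ (n : ℤ) (x y : ℝ), (x, y) ∈ closedFluid η →
      ψ (x + n * (2 * Real.pi), y) = ψ (x, y) := by
    intro n x y hxy
    -- Periodicity of `ψ` is known only in the fluid; extension by zero makes it global, so that it
    -- can be iterated over integers.
    have hp : Function.Periodic (fun x => (closedFluid η).indicator ψ (x, y)) (2 * Real.pi) := by
      intro x
      by_cases hx : (x, y) ∈ closedFluid η
      · have hx' : (x + 2 * Real.pi, y) ∈ closedFluid η :=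
          ⟨hx.1, hx.2.trans_eq (h.profile_periodic x).symm⟩
        simp only
        rw [indicator_of_mem hx, indicator_of_mem hx', h.periodic x y hx]
      · have hx' : (x + 2 * Real.pi, y) ∉ closedFluid η := fun hc =>
          hx ⟨hc.1, hc.2.trans_eq (h.profile_periodic x)⟩
        simp only
        rw [indicator_of_notMem hx, indicator_of_notMem hx']
    have hmem : (x + n * (2 * Real.pi), y) ∈ closedFluid η :=
      ⟨hxy.1, hxy.2.trans_eq ((Function.Periodic.int_mul h.profile_periodic n) x).symm⟩
    have := (hp.int_mul n) x
    rwa [indicator_of_mem hxy, indicator_of_mem hmem] at this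
  have hηper : ∀ (n : ℤ) (x : ℝ), η (x + n * (2 * Real.pi)) = η x := fun n x =>
    (Function.Periodic.int_mul h.profile_periodic n) x
  intro x y hxy
  obtain ⟨n, hn⟩ : ∃ n : ℤ, |x + n * (2 * Real.pi) - c| ≤ Real.pi := by
    obtain ⟨n, hn, -⟩ := existsUnique_add_zsmul_mem_Ico Real.two_pi_pos x (c - Real.pi)
    refine ⟨n, ?_⟩
    rw [zsmul_eq_mul] at hn
    rw [abs_le]
    constructor <;> linarith [hn.1, hn.2]
  set s := x + n * (2 * Real.pi) - c with hs
  have e1 : x + n * (2 * Real.pi) = c - (-s) := by rw [hs]; ring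
  have e2 : 2 * c - x = c + (-s) + n * (2 * Real.pi) := by rw [hs]; ring
  have hmem : (c - (-s), y) ∈ closedFluid η := by
    rw [← e1]; exact ⟨hxy.1, hxy.2.trans_eq (hηper n x).symm⟩
  have hs' : |-s| ≤ Real.pi := by rwa [abs_neg]
  have hmem2 : (c + (-s), y) ∈ closedFluid η := ⟨hxy.1, hmem.2.trans_eq (hη' (-s) hs')⟩
  rw [e2]
  refine ⟨⟨hxy.1, hmem2.2.trans_eq (hηper n _).symm⟩, ?_⟩
  rw [hper n _ _ hmem2, ← hψ' (-s) hs' y hxy.1 hmem.2, ← e1, hper n _ _ hxy]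

theorem SolvesStratifiedSystem.isSymmetricAbout_of_touching (h : IsPeriodicFlow η ψ)
    (hs : SolvesStratifiedSystem g A B γ Q p₀ η ψ) {m σ : ℝ} (hm : 0 ≤ m) (hmη : ∀ x, m ≤ η x)
    (hσ1 : σ ^ 2 = 1)
    (hσ : ∀ x y, m ≤ y → y ≤ η x → 0 < σ * partialY (closedFluid η) ψ (x, y))
    {c θ : ℝ} (hθ : θ ^ 2 = 1)
    (hle : ∀ s ∈ Icc 0 Real.pi, η (c - θ * s) ≤ η (c + θ * s))
    (htouch : (∃ s ∈ Ioo 0 Real.pi, η (c - θ * s) = η (c + θ * s)) ∨ deriv η c = 0) :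
    IsSymmetricAbout η ψ c := by
  have hψ := hs.eq_reflection_of_touching h hm hmη hσ1 hσ hθ hle htouch
  refine h.isSymmetricAbout_of_half_period hθ (fun s hs' => ?_) hψ
  -- A gap between the profiles would produce a zero of `ψ` strictly below the surface, at or above
  -- level `m`, where `σ ψ < 0`.
  refine (hle s hs').eq_or_lt.resolve_right fun hlt => ?_
  have h1 := hψ s hs' _ (h.profile_pos _).le le_rfl
  have h2 := hs.sign_mul_lt_zero h hm hσ (hmη (c - θ * s)) hlt
  rw [← h1, hs.surface, mul_zero] at h2
  exact lt_irrefl _ h2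

end Reflection

/-! ### Choice of the reflection axis. -/

/-- The mean value theorem gives points with nonpositive derivative squeezed towards `p`; continuity
of the derivative does the rest. -/
theorem deriv_nonpos_of_tendsto_of_le {f : ℝ → ℝ} (hf : ContDiff ℝ 1 f) {u v : ℕ → ℝ} {p : ℝ}
    (hu : Tendsto u atTop (𝓝 p)) (hv : Tendsto v atTop (𝓝 p)) (huv : ∀ n, u n < v n)
    (hle : ∀ n, f (v n) ≤ f (u n)) : deriv f p ≤ 0 := by
  have hslope : ∀ n, ∃ ξ ∈ Ioo (u n) (v n), deriv f ξ ≤ 0 := by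
    intro n
    obtain ⟨ξ, hξ, hd⟩ := exists_deriv_eq_slope f (huv n) hf.continuous.continuousOn
      (hf.differentiable one_ne_zero).differentiableOn
    exact ⟨ξ, hξ, hd ▸ div_nonpos_of_nonpos_of_nonneg (sub_nonpos.2 (hle n))
      (sub_nonneg.2 (huv n).le)⟩
  choose ξ hξ hd using hslope
  have hξp : Tendsto ξ atTop (𝓝 p) :=
    tendsto_of_tendsto_of_tendsto_of_le_of_le hu hv (fun n => (hξ n).1.le) (fun n => (hξ n).2.le)
  exact le_of_tendsto (((hf.continuous_deriv le_rfl).tendsto p).comp hξp) (Eventually.of_forall hd)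

theorem deriv_nonneg_of_tendsto_of_le {f : ℝ → ℝ} (hf : ContDiff ℝ 1 f) {u v : ℕ → ℝ} {p : ℝ}
    (hu : Tendsto u atTop (𝓝 p)) (hv : Tendsto v atTop (𝓝 p)) (huv : ∀ n, u n < v n)
    (hle : ∀ n, f (u n) ≤ f (v n)) : 0 ≤ deriv f p := by
  have := deriv_nonpos_of_tendsto_of_le hf.neg hu hv huv fun n => neg_le_neg (hle n)
  rw [deriv.fun_neg] at this
  linarith

section Axis

variable {η : ℝ → ℝ}

/-- On a half period, the profile lies below its reflection across `x = c`. -/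
def LiesBelowReflection (η : ℝ → ℝ) (c : ℝ) : Prop :=
  ∀ s ∈ Icc 0 Real.pi, η (c - s) ≤ η (c + s)

theorem trough_le_and_le_crest (hper : ∀ x, η (x + 2 * Real.pi) = η x) {c : ℝ}
    (hc : c ∈ Ioo (-Real.pi) Real.pi) (hmono : MonotoneOn η (Icc (-Real.pi) c))
    (hanti : AntitoneOn η (Icc c Real.pi)) (x : ℝ) : η Real.pi ≤ η x ∧ η x ≤ η c := by
  have hends : η (-Real.pi) = η Real.pi := by
    rw [← hper (-Real.pi)]; congr 1; ring
  obtain ⟨n, hn, -⟩ := existsUnique_add_zsmul_mem_Ico Real.two_pi_pos x (-Real.pi)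
  rw [zsmul_eq_mul] at hn
  rw [← (Function.Periodic.int_mul hper n) x]
  set y := x + n * (2 * Real.pi)
  have h2 : y < Real.pi := by linarith [hn.2]
  have hcI : c ∈ Icc (-Real.pi) c := ⟨hc.1.le, le_rfl⟩
  have hcJ : c ∈ Icc c Real.pi := ⟨le_rfl, hc.2.le⟩
  rcases le_total y c with hy | hy
  · exact ⟨hends ▸ hmono ⟨le_rfl, hc.1.le⟩ ⟨hn.1, hy⟩ hn.1, hmono ⟨hn.1, hy⟩ hcI hy⟩
  · exact ⟨hanti ⟨hy, h2.le⟩ ⟨hc.2.le, le_rfl⟩ h2.le, hanti hcJ ⟨hy, h2.le⟩ hy⟩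

/-- There is an axis across which the reflected profile lies above the profile and either touches
it, or is tangent to it on the axis or half a period away from the axis. -/
theorem exists_touching_axis (hη : ContDiff ℝ 1 η) (hper : ∀ x, η (x + 2 * Real.pi) = η x) {c : ℝ}
    (hc : c ∈ Ioo (-Real.pi) Real.pi) (hmono : MonotoneOn η (Icc (-Real.pi) c))
    (hanti : AntitoneOn η (Icc c Real.pi)) :
    ∃ l ∈ Icc ((c - Real.pi) / 2) ((c + Real.pi) / 2), LiesBelowReflection η l ∧
      ((∃ s ∈ Ioo 0 Real.pi, η (l - s) = η (l + s)) ∨ deriv η l = 0 ∨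
        deriv η (l - Real.pi) = 0) := by
  have hpi := Real.pi_pos
  obtain ⟨hc1, hc2⟩ := hc
  have hηc := hη.continuous
  have hper' : ∀ x, η (x - 2 * Real.pi) = η x := fun x => by
    rw [← hper (x - 2 * Real.pi), sub_add_cancel]
  -- This axis swaps the crest `c` with the trough `-π`, so mirror points lie on one monotone branch
  -- up to periodicity. The other endpoint swaps `c` with `π` and reverses the ordering.
  have hleft : LiesBelowReflection η ((c - Real.pi) / 2) := by
    rintro s ⟨h0, h1⟩
    rcases le_total s ((c + Real.pi) / 2) with h | h
    · exact hmono ⟨by linarith, by linarith⟩ ⟨by linarith, by linarith⟩ (by linarith)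
    · rw [← hper]
      exact hanti ⟨by linarith, by linarith⟩ ⟨by linarith, by linarith⟩ (by linarith)
  have hright : ∀ s ∈ Icc 0 Real.pi, η ((c + Real.pi) / 2 + s) ≤ η ((c + Real.pi) / 2 - s) := by
    rintro s ⟨h0, h1⟩
    rcases le_total s ((Real.pi - c) / 2) with h | h
    · exact hanti ⟨by linarith, by linarith⟩ ⟨by linarith, by linarith⟩ (by linarith)
    · rw [← hper']
      exact hmono ⟨by linarith, by linarith⟩ ⟨by linarith, by linarith⟩ (by linarith)
  have hcompact : IsCompact (Icc ((c - Real.pi) / 2) ((c + Real.pi) / 2) ∩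
      {l | LiesBelowReflection η l}) := by
    refine isCompact_Icc.inter_right ?_
    have : {l | LiesBelowReflection η l} =
        ⋂ s ∈ Icc 0 Real.pi, {l | η (l - s) ≤ η (l + s)} := by
      ext l; simp [LiesBelowReflection]
    rw [this]
    exact isClosed_biInter fun s _ => isClosed_le (by fun_prop) (by fun_prop)
  obtain ⟨l, ⟨hlI, hl⟩, hmax⟩ := hcompact.exists_isGreatest
    ⟨(c - Real.pi) / 2, ⟨le_rfl, by linarith⟩, hleft⟩
  have hl : LiesBelowReflection η l := hl
  refine ⟨l, hlI, hl, ?_⟩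
  rcases hlI.2.eq_or_lt with hlr | hlr
  · refine Or.inl ⟨Real.pi / 2, ⟨by linarith, by linarith⟩, ?_⟩
    have hmem : Real.pi / 2 ∈ Icc 0 Real.pi := ⟨by linarith, by linarith⟩
    exact le_antisymm (hl _ hmem) (hlr ▸ hright _ hmem)
  -- By maximality of `l`, axes slightly to its right violate the ordering; a limit `s₀` of the
  -- violating offsets locates the contact.
  obtain ⟨r, hranti, hrmem, hrl⟩ := exists_seq_strictAnti_tendsto' hlr
  have hbad : ∀ n, ∃ s ∈ Icc 0 Real.pi, η (r n + s) < η (r n - s) := by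
    intro n
    by_contra! hgood
    have := hmax ⟨⟨hlI.1.trans (hrmem n).1.le, (hrmem n).2.le⟩, hgood⟩
    exact absurd (hrmem n).1 (not_lt.2 this)
  choose s hs hlt using hbad
  obtain ⟨s₀, hs₀, φ, hφ, hsφ⟩ := isCompact_Icc.tendsto_subseq hs
  have hrφ : Tendsto (fun n => r (φ n)) atTop (𝓝 l) := hrl.comp hφ.tendsto_atTop
  have hsφ : Tendsto (fun n => s (φ n)) atTop (𝓝 s₀) := hsφ
  have hadd := hrφ.add hsφ
  have hsub := hrφ.sub hsφ
  have heq : η (l - s₀) = η (l + s₀) := by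
    refine le_antisymm (hl s₀ hs₀) ?_
    exact le_of_tendsto_of_tendsto' ((hηc.tendsto _).comp hadd) ((hηc.tendsto _).comp hsub)
      fun n => (hlt (φ n)).le
  have hinv : Tendsto (fun n : ℕ => 1 / ((n : ℝ) + 1)) atTop (𝓝 0) :=
    tendsto_one_div_add_atTop_nhds_zero_nat
  have hinvpos : ∀ n : ℕ, 0 < 1 / ((n : ℝ) + 1) := fun n => by positivity
  have hinvle : ∀ n : ℕ, 1 / ((n : ℝ) + 1) ≤ Real.pi := fun n => by
    have : 1 / ((n : ℝ) + 1) ≤ 1 := (div_le_one (by positivity)).2 (by simp)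
    linarith [Real.pi_gt_three]
  -- When the offsets collapse onto the axis, the violations give `η' ≤ 0` at `l` and the ordering
  -- at `l` itself gives `η' ≥ 0`. Offsets tending to `π` do the same at `l - π`, with signs
  -- reversed.
  rcases hs₀.1.eq_or_lt with h0 | h0
  · right; left
    rw [← h0, add_zero] at hadd
    rw [← h0, sub_zero] at hsub
    refine le_antisymm ?_ ?_
    · refine deriv_nonpos_of_tendsto_of_le hη hsub hadd (fun n => ?_) fun n => (hlt (φ n)).le
      refine lt_of_le_of_ne (by linarith [(hs (φ n)).1]) fun h => ?_
      exact (hlt (φ n)).ne (by rw [h])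
    · refine deriv_nonneg_of_tendsto_of_le hη (u := fun n : ℕ => l - 1 / ((n : ℝ) + 1))
        (v := fun n : ℕ => l + 1 / ((n : ℝ) + 1)) ?_ ?_
        (fun n => by linarith [hinvpos n]) fun n => hl _ ⟨(hinvpos n).le, hinvle n⟩
      · simpa using hinv.const_sub l
      · simpa using hinv.const_add l
  rcases hs₀.2.eq_or_lt with h1 | h1
  · right; right
    rw [h1] at hadd hsub
    have hadd' : Tendsto (fun n => r (φ n) + s (φ n) - 2 * Real.pi) atTop (𝓝 (l - Real.pi)) := by
      have := hadd.sub_const (2 * Real.pi)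
      rwa [show l + Real.pi - 2 * Real.pi = l - Real.pi by ring] at this
    refine le_antisymm ?_ ?_
    · refine deriv_nonpos_of_tendsto_of_le hη
        (u := fun n : ℕ => l - Real.pi - 1 / ((n : ℝ) + 1))
        (v := fun n : ℕ => l - Real.pi + 1 / ((n : ℝ) + 1)) ?_ ?_
        (fun n => by linarith [hinvpos n]) fun n => ?_
      · simpa using hinv.const_sub (l - Real.pi)
      · simpa using hinv.const_add (l - Real.pi)
      · have := hl (Real.pi - 1 / ((n : ℝ) + 1)) ⟨by linarith [hinvle n], by linarith [hinvpos n]⟩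
        rw [← hper' (l + _)] at this
        convert this using 2 <;> ring
    · refine deriv_nonneg_of_tendsto_of_le hη hadd' hsub (fun n => ?_) fun n => ?_
      · refine lt_of_le_of_ne (by linarith [(hs (φ n)).2]) fun h => ?_
        exact (hlt (φ n)).ne (by rw [← h, hper'])
      · rw [hper']
        exact (hlt (φ n)).le
  · exact Or.inl ⟨s₀, ⟨h0, h1⟩, heq⟩

end Axis

/-! ### Symmetry about some axis, then about the origin. -/

theorem IsPeriodicFlow.isSymmetricAbout_of_sub_pi {η : ℝ → ℝ} {ψ : ℝ × ℝ → ℝ}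
    (h : IsPeriodicFlow η ψ) {c : ℝ} (hsym : IsSymmetricAbout η ψ (c - Real.pi)) :
    IsSymmetricAbout η ψ c := by
  intro x y hxy
  obtain ⟨h1, h2⟩ := hsym x y hxy
  have e : 2 * c - x = 2 * (c - Real.pi) - x + 2 * Real.pi := by ring
  rw [e, h.periodic _ _ h1]
  exact ⟨⟨h1.1, h1.2.trans_eq (h.profile_periodic _).symm⟩, h2⟩

theorem theorem4p1 (g A B γ Q p₀ : ℝ) (hg : 0 < g) (hB : 0 < B)
    (η : ℝ → ℝ) (ψ : ℝ × ℝ → ℝ)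
    (hflow : IsPeriodicFlow η ψ)
    (hsol : SolvesStratifiedSystem g A B γ Q p₀ η ψ)
    (hmono : MonotoneCrestTrough η)
    (hstag : StagnationBelowTrough η ψ) :
    (∀ x y, (x, y) ∈ closedFluid η → (-x, y) ∈ closedFluid η ∧ ψ (-x, y) = ψ (x, y)) ∧
      (∀ x, η (-x) = η x) ∧ (∀ x, η x ≤ η 0) := by
  obtain ⟨c, hc, hinc, hdec⟩ := hmono
  have hper := hflow.profile_periodic
  have hbounds := trough_le_and_le_crest hper hc hinc hdec
  have hpos := hflow.profile_pos
  have hper' : ∀ x, η (x - 2 * Real.pi) = η x := fun x => by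
    rw [← hper (x - 2 * Real.pi), sub_add_cancel]
  have hends : η (-Real.pi) = η Real.pi := by
    rw [← hper (-Real.pi)]; congr 1; ring
  obtain ⟨σ, hσ1, hσ⟩ := hflow.exists_sign_partialY (hpos Real.pi).le (fun x => (hbounds x).1)
    fun x y h1 h2 h0 => absurd (hstag x y ⟨(hpos _).le.trans h1, h2⟩ h0) (not_lt.2 h1)
  have hsymm : ∀ {l θ : ℝ}, θ ^ 2 = 1 →
      (∀ s ∈ Icc 0 Real.pi, η (l - θ * s) ≤ η (l + θ * s)) →
      ((∃ s ∈ Ioo 0 Real.pi, η (l - θ * s) = η (l + θ * s)) ∨ deriv η l = 0) →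
      IsSymmetricAbout η ψ l := fun hθ =>
    hsol.isSymmetricAbout_of_touching hflow (hpos Real.pi).le (fun x => (hbounds x).1) hσ1 hσ hθ
  have htrough : deriv η Real.pi = 0 :=
    IsLocalMin.deriv_eq_zero (Eventually.of_forall fun x => (hbounds x).1)
  obtain ⟨l, hlI, hbelow, htouch⟩ := exists_touching_axis hflow.profile_contDiff hper hc hinc hdec
  have hl : IsSymmetricAbout η ψ l := by
    rcases htouch with htouch | htouch | htouch
    · exact hsymm (θ := 1) (one_pow 2) (fun s hs => by simpa using hbelow s hs) (Or.inl (by simpa using htouch))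
    · exact hsymm (θ := 1) (one_pow 2) (fun s hs => by simpa using hbelow s hs) (Or.inr htouch)
    -- Measured from `l - π` the offset `s` becomes `π - s`, which exchanges the lower and upper
    -- sides; hence `θ = -1`.
    · refine hflow.isSymmetricAbout_of_sub_pi
        (hsymm (θ := -1) (by norm_num) (fun s hs => ?_) (Or.inr htouch))
      have := hbelow (Real.pi - s) ⟨by linarith [hs.2], by linarith [hs.1]⟩
      rw [← hper' (l + _)] at this
      convert this using 2 <;> ring
  have hzero : IsSymmetricAbout η ψ 0 := by
    have hη := hl.profile_eq hpos
    have hpi_zero : IsSymmetricAbout η ψ Real.pi → IsSymmetricAbout η ψ 0 := by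
      intro h x y hxy
      obtain ⟨h1, h2⟩ := h x y hxy
      have e : 2 * Real.pi - x = 2 * 0 - x + 2 * Real.pi := by ring
      have h3 : (2 * 0 - x, y) ∈ closedFluid η := by
        rw [e] at h1
        exact ⟨h1.1, h1.2.trans_eq (hper _)⟩
      rw [e, hflow.periodic _ _ h3] at h2
      exact ⟨h3, h2⟩
    rcases lt_trichotomy l 0 with h | rfl | h
    · refine hpi_zero (hsymm (θ := 1) (one_pow 2) (fun s hs => ?_) (Or.inr htrough))
      -- If `x` and `-x` do not both lie on the decreasing branch, reflecting `x` in `l < 0` puts `2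
      -- l - x` left of `-x`, on the increasing branch, unless it passes the trough `-π`.
      have key : ∀ x ∈ Icc 0 Real.pi, η x ≤ η (-x) := by
        intro x hx
        rcases le_or_gt c (-x) with h1 | h1
        · exact hdec ⟨h1, by linarith [hx.1, hx.2]⟩ ⟨by linarith [hx.1], hx.2⟩ (by linarith [hx.1])
        rcases le_or_gt (-Real.pi) (2 * l - x) with h2 | h2
        · rw [← hη x]
          exact hinc ⟨h2, by linarith⟩ ⟨by linarith, h1.le⟩ (by linarith)
        -- Here `x` lies beyond the mirror image `2 l + π` of the trough, so `η x` is at trough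
        -- level. The bound `l ≥ (c - π) / 2` places that image on the decreasing branch.
        · have h3 := hdec (a := 2 * l + Real.pi) (b := x) ⟨by linarith [hlI.1], by linarith⟩
            ⟨by linarith [hlI.1], hx.2⟩ (by linarith)
          rw [← hη (2 * l + Real.pi), show 2 * l - (2 * l + Real.pi) = -Real.pi by ring, hends] at h3
          exact h3.trans (hbounds _).1
      have := key (Real.pi - s) ⟨by linarith [hs.2], by linarith [hs.1]⟩
      rw [← hper (-(Real.pi - s))] at this
      convert this using 2 <;> ring
    · exact hl
    · refine hpi_zero (hsymm (θ := -1) (by norm_num) (fun s hs => ?_) (Or.inr htrough))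
      have key : ∀ x ∈ Icc 0 Real.pi, η (-x) ≤ η x := by
        intro x hx
        rcases le_or_gt x c with h1 | h1
        · exact hinc ⟨by linarith [hx.2], by linarith [hx.1]⟩
            ⟨by linarith [hx.1, Real.pi_pos], h1⟩
            (by linarith [hx.1])
        rcases le_or_gt (2 * l + x) Real.pi with h2 | h2
        · rw [← hη (-x), sub_neg_eq_add]
          exact hdec ⟨h1.le, hx.2⟩ ⟨by linarith, h2⟩ (by linarith)
        · have h3 := hinc (a := -x) (b := 2 * l - Real.pi) ⟨by linarith [hx.2], by linarith [hlI.2]⟩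
            ⟨by linarith, by linarith [hlI.2]⟩ (by linarith)
          rw [← hη (2 * l - Real.pi), show 2 * l - (2 * l - Real.pi) = Real.pi by ring] at h3
          exact h3.trans (hbounds _).1
      have := key (Real.pi - s) ⟨by linarith [hs.2], by linarith [hs.1]⟩
      rw [← hper (-(Real.pi - s))] at this
      convert this using 2 <;> ring
  have heven : ∀ x, η (-x) = η x := fun x => by simpa using hzero.profile_eq hpos x
  refine ⟨fun x y hxy => by simpa using hzero x y hxy, heven, fun x => (hbounds x).2.trans ?_⟩
  rcases le_total c 0 with h | h
  · have := hdec (a := 0) (b := -c) ⟨h, Real.pi_pos.le⟩ ⟨by linarith, by linarith [hc.1]⟩ (by linarith)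
    rwa [heven] at this
  · have := hinc (a := -c) (b := 0) ⟨by linarith [hc.2], by linarith⟩ ⟨by linarith [Real.pi_pos], h⟩
      (by linarith)
    rwa [heven] at this
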